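/- Let $p$ be a prime and let $L/K$ be a finite Galois extension of $p$-adic fields (finite extensions of $\mathbb{Q}_p$) with group $G$, at most tamely ramified, i.e. with ramification index prime to $p$. Let $\mathfrak{O}_L$ be the valuation ring of $L$ and let $G_0 \subseteq G$ be the inertia group, the subgroup of all $g \in G$ acting trivially on $\mathfrak{O}_L$ modulo its maximal ideal. For $g\in G$ let $\lambda(g) \in \mathrm{Perm}(G)$ be left translation by $g$, and let $N$ be a regular (i.e. simply transitive) subgroup of $\mathrm{Perm}(G)$ that is normalized by $\lambda(G)$. Let $G$ act on $N$ by $\eta \mapsto \lambda(g)\eta\lambda(g)^{-1}$ and on the group ring $\Lambda = \mathfrak{O}_L[N]$ by $\sum_{\eta} c_\eta \eta \mapsto \sum_{\eta} g(c_\eta)\, \lambda(g)\eta\lambda(g)^{-1}$. The ring $\Lambda^G = \mathfrak{O}_L[N]^G$ of fixed elements acts on every fractional ideal of $L$ by $$\Big(\sum_{\eta\in N} c_\eta \eta\Big)\cdot x = \sum_{\eta \in N} c_\eta\, \eta^{-1}(1_G)[x].$$ Suppose that $N$ is abelian and that $G_0$ acts trivially on the $p$-part of $N$ (the subgroup of elements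 of $p$-power order). Then every fractional ideal $\mathfrak{B}$ of $L$ is a free $\Lambda^G$-module. -/

import Mathlib

open scoped nonZeroDivisors

noncomputable section

namespace PadicHopfGalois

section Integers

variable (p : ℕ) [Fact p.Prime]

/-- The valuation ring `𝔒_F` of a finite extension `F` of `ℚ_p`: the integral closure of `ℤ_p`
in `F`. -/
abbrev Integers (F : Type*) [Field F] [Algebra ℤ_[p] F] : Subalgebra ℤ_[p] F :=
  integralClosure ℤ_[p] F

variable {p} in
theorem spectralNorm_mul_eq {F : Type*} [Field F] [Algebra ℚ_[p] F] [FiniteDimensional ℚ_[p] F]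
    (x y : F) : spectralNorm ℚ_[p] F (x * y) =
      spectralNorm ℚ_[p] F x * spectralNorm ℚ_[p] F y :=
  map_mul (spectralMulAlgNorm ℚ_[p] F) x y

section Local

variable {F : Type*} [Field F] [Algebra ℤ_[p] F] [Algebra ℚ_[p] F] [IsScalarTower ℤ_[p] ℚ_[p] F]
  [FiniteDimensional ℚ_[p] F]

variable {p} in
theorem mem_integers_iff (x : F) : x ∈ Integers p F ↔ spectralNorm ℚ_[p] F x ≤ 1 := by
  rw [spectralNorm, spectralValue_le_one_iff
    (minpoly.monic (Algebra.IsIntegral.isIntegral (R := ℚ_[p]) x))]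
  constructor
  · intro hx n
    have hx' : IsIntegral ℤ_[p] x := hx
    rw [minpoly.isIntegrallyClosed_eq_field_fractions' ℚ_[p] hx', Polynomial.coeff_map]
    exact PadicInt.norm_le_one _
  · intro h
    have hl : minpoly ℚ_[p] x ∈ Polynomial.lifts (algebraMap ℤ_[p] ℚ_[p]) := by
      rw [Polynomial.lifts_iff_coeff_lifts]
      intro n
      exact ⟨⟨_, h n⟩, rfl⟩
    obtain ⟨q, hq, -, hqm⟩ := Polynomial.lifts_and_natDegree_eq_and_monic hl
      (minpoly.monic (Algebra.IsIntegral.isIntegral (R := ℚ_[p]) x))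
    refine ⟨q, hqm, ?_⟩
    rw [IsScalarTower.algebraMap_eq ℤ_[p] ℚ_[p] F, ← Polynomial.eval₂_map, hq]
    exact minpoly.aeval ℚ_[p] x

variable {p} in
theorem mem_or_inv_mem_integers (x : F) : x ∈ Integers p F ∨ x⁻¹ ∈ Integers p F := by
  rcases eq_or_ne x 0 with rfl | hx
  · exact Or.inl (zero_mem _)
  rw [mem_integers_iff, mem_integers_iff]
  have h := spectralNorm_mul_eq (p := p) x x⁻¹
  rw [mul_inv_cancel₀ hx, spectralNorm_one] at h
  by_contra! hc
  nlinarith [hc.1, hc.2]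

variable (F) in
/-- The ring `𝔒_F` is local. -/
instance isLocalRing_integers : IsLocalRing (Integers p F) :=
  IsLocalRing.of_isUnit_or_isUnit_of_isUnit_add fun a b hab => by
    have key : ∀ a b : Integers p F, IsUnit (a + b) → (a : F) ≠ 0 →
        (b : F) * (a : F)⁻¹ ∈ Integers p F → IsUnit a := by
      intro a b hab ha hb
      have h : a + b = a * (1 + ⟨_, hb⟩) := by
        apply Subtype.ext
        push_cast
        field_simp
      rw [h] at hab
      exact isUnit_of_mul_isUnit_left hab
    rcases eq_or_ne (a : F) 0 with ha | ha
    · right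
      have : a = 0 := Subtype.ext ha
      simpa [this] using hab
    rcases eq_or_ne (b : F) 0 with hb | hb
    · left
      have : b = 0 := Subtype.ext hb
      simpa [this] using hab
    rcases mem_or_inv_mem_integers (p := p) ((b : F) * (a : F)⁻¹) with h | h
    · exact Or.inl (key a b hab ha h)
    · refine Or.inr (key b a (by rwa [add_comm]) hb ?_)
      rwa [mul_inv, inv_inv, mul_comm] at h

end Local

variable (K L : Type*) [Field K] [Field L] [Algebra K L]
  [Algebra ℤ_[p] K] [Algebra ℤ_[p] L] [IsScalarTower ℤ_[p] K L]

/-- For an extension `L/K`, the ring `𝔒_L` is an `𝔒_K`-algebra by restriction of `K → L`. -/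
instance integersAlgebra : Algebra (Integers p K) (Integers p L) :=
  (IsScalarTower.toAlgHom ℤ_[p] K L).mapIntegralClosure.toRingHom.toAlgebra

variable [Algebra ℚ_[p] L] [IsScalarTower ℤ_[p] ℚ_[p] L] [FiniteDimensional ℚ_[p] L]

/-- `L/K` is at most tamely ramified: its ramification index is prime to `p`. (The residue fields
are finite, so the residue extension is automatically separable.) -/
def IsTame : Prop :=
  ¬ p ∣ (IsLocalRing.maximalIdeal (Integers p L)).ramificationIdx (Integers p K)

/-- The inertia group `G₀`: all `g` in `Gal(L/K)` that act trivially modulo the maximal ideal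
of `𝔒_L`. -/
def inertiaGroup : Subgroup Gal(L/K) :=
  (IsLocalRing.maximalIdeal (Integers p L)).toAddSubgroup.inertia Gal(L/K)

end Integers

section Permutations

/-- A group of permutations of `X` is regular if it acts simply transitively on `X`. -/
def IsRegular {X : Type*} (N : Subgroup (Equiv.Perm X)) : Prop :=
  ∀ x y : X, ∃! η : N, (η : Equiv.Perm X) x = y

variable {G : Type*} [Group G]

/-- `N` is normalized by `λ(G)`, where `λ(g)` is left translation by `g`. -/
def IsTranslationNormalized (N : Subgroup (Equiv.Perm G)) : Prop :=
  ∀ g : G, Equiv.mulLeft g ∈ Subgroup.normalizer (N : Set (Equiv.Perm G))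

variable {N : Subgroup (Equiv.Perm G)}

/-- The action of `g` on `N`: conjugation by the left translation `λ(g)`. -/
def conj (hN : IsTranslationNormalized N) (g : G) : N ≃* N :=
  N.normalizerMonoidHom ⟨Equiv.mulLeft g, hN g⟩

theorem coe_conj (hN : IsTranslationNormalized N) (g : G) (η : N) :
    (conj hN g η : Equiv.Perm G) =
      Equiv.mulLeft g * (η : Equiv.Perm G) * (Equiv.mulLeft g)⁻¹ :=
  rfl

/-- The `p`-part of `N`: its elements of `p`-power order. -/
def pPart (p : ℕ) (N : Subgroup (Equiv.Perm G)) : Set N :=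
  {η | ∃ k : ℕ, η ^ p ^ k = 1}

end Permutations

section Action

variable {p : ℕ} [Fact p.Prime] {K L : Type*} [Field K] [Field L] [Algebra K L]
  [Algebra ℤ_[p] L] {N : Subgroup (Equiv.Perm Gal(L/K))}

/-- The formula `(∑ c_η η) · x = ∑ c_η η⁻¹(1)[x]`, in which `η⁻¹(1)` is an element of
`Gal(L/K)` and is applied to `x`. -/
def act (z : MonoidAlgebra (Integers p L) N) (x : L) : L :=
  z.coeff.sum fun η c => (c : L) * ((η : Equiv.Perm Gal(L/K))⁻¹ 1) x

/-- Auxiliary variant of `act` with `η⁻¹(h)` in place of `η⁻¹(1)`, additive in the group ring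
element. -/
def actAt (h : Gal(L/K)) (x : L) : MonoidAlgebra (Integers p L) N →+ L where
  toFun z := z.coeff.sum fun η c => (c : L) * ((η : Equiv.Perm Gal(L/K))⁻¹ h) x
  map_zero' := by simp
  map_add' a b := by
    rw [MonoidAlgebra.coeff_add, Finsupp.sum_add_index'] <;> simp [add_mul]

theorem act_eq (z : MonoidAlgebra (Integers p L) N) (x : L) : act z x = actAt 1 x z := rfl

theorem actAt_single (h : Gal(L/K)) (x : L) (η : N) (c : Integers p L) :
    actAt h x (MonoidAlgebra.single η c) = (c : L) * ((η : Equiv.Perm Gal(L/K))⁻¹ h) x := by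
  simp [actAt]

theorem actAt_single_mul (h : Gal(L/K)) (x : L) (η : N) (c : Integers p L)
    (w : MonoidAlgebra (Integers p L) N) :
    actAt h x (MonoidAlgebra.single η c * w) =
      (c : L) * actAt ((η : Equiv.Perm Gal(L/K))⁻¹ h) x w := by
  induction w using MonoidAlgebra.induction_linear with
  | zero => simp
  | add a b ha hb => rw [mul_add, map_add, ha, hb, map_add, mul_add]
  | single μ d =>
    rw [MonoidAlgebra.single_mul_single, actAt_single, actAt_single]
    simp [mul_assoc]

theorem act_add_right (z : MonoidAlgebra (Integers p L) N) (x y : L) :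
    act z (x + y) = act z x + act z y := by
  simp [act, mul_add, Finsupp.sum_add]

theorem act_zero_right (z : MonoidAlgebra (Integers p L) N) : act z (0 : L) = 0 := by
  simp [act]

variable [Algebra ℚ_[p] L] [IsScalarTower ℤ_[p] ℚ_[p] L] [FiniteDimensional ℚ_[p] L]
  [Algebra ℚ_[p] K] [IsScalarTower ℚ_[p] K L]

/-- Every fractional ideal of `L` (indeed every `𝔒_L`-submodule) is stable under `Gal(L/K)`. -/
theorem gal_mem (I : Submodule (Integers p L) L) (g : Gal(L/K)) {x : L} (hx : x ∈ I) :
    g x ∈ I := by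
  rcases eq_or_ne x 0 with rfl | hx0
  · simp
  have hu : g x * x⁻¹ ∈ Integers p L := by
    have h : spectralNorm ℚ_[p] L x * spectralNorm ℚ_[p] L x⁻¹ = 1 := by
      rw [← spectralNorm_mul_eq, mul_inv_cancel₀ hx0, spectralNorm_one]
    have h2 := spectralNorm_eq_of_equiv (g.restrictScalars ℚ_[p]) x
    rw [AlgEquiv.restrictScalars_apply] at h2
    rw [mem_integers_iff, spectralNorm_mul_eq, ← h2, h]
  have h3 : g x = (⟨_, hu⟩ : Integers p L) • x := by
    rw [Subalgebra.smul_def, smul_eq_mul, inv_mul_cancel_right₀ hx0]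
  rw [h3]
  exact I.smul_mem _ hx

theorem act_mem (I : Submodule (Integers p L) L) (z : MonoidAlgebra (Integers p L) N) {x : L}
    (hx : x ∈ I) : act z x ∈ I :=
  I.sum_mem fun η _ => I.smul_mem (z.coeff η) (gal_mem I _ hx)

end Action

section Order

variable {p : ℕ} [Fact p.Prime] {K L : Type*} [Field K] [Field L] [Algebra K L]
  [Algebra ℤ_[p] K] [Algebra ℤ_[p] L] [IsScalarTower ℤ_[p] K L]
  {N : Subgroup (Equiv.Perm Gal(L/K))}

variable (p) in
/-- The action of `g` in `Gal(L/K)` on `Λ = 𝔒_L[N]`, by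
`∑ c_η η ↦ ∑ g(c_η) λ(g) η λ(g)⁻¹`. -/
def galoisAction (hN : IsTranslationNormalized N) (g : Gal(L/K)) :
    MonoidAlgebra (Integers p L) N →+* MonoidAlgebra (Integers p L) N :=
  (MonoidAlgebra.mapDomainRingHom (Integers p L) (conj hN g).toMonoidHom).comp
    (MonoidAlgebra.mapRingHom N (MulSemiringAction.toRingHom Gal(L/K) (Integers p L) g))

theorem galoisAction_single (hN : IsTranslationNormalized N) (g : Gal(L/K)) (η : N)
    (c : Integers p L) :
    galoisAction p hN g (MonoidAlgebra.single η c) = MonoidAlgebra.single (conj hN g η) (g • c) := by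
  simp [galoisAction]

variable (p) in
/-- The ring `Λ^G = 𝔒_L[N]^G` of elements of `𝔒_L[N]` fixed by `G = Gal(L/K)`. -/
def fixedOrder (hN : IsTranslationNormalized N) : Subring (MonoidAlgebra (Integers p L) N) where
  carrier := {z | ∀ g : Gal(L/K), galoisAction p hN g z = z}
  mul_mem' ha hb g := by rw [map_mul, ha g, hb g]
  one_mem' g := map_one _
  add_mem' ha hb g := by rw [map_add, ha g, hb g]
  zero_mem' g := map_zero _
  neg_mem' ha g := by rw [map_neg, ha g]

theorem gal_actAt (hN : IsTranslationNormalized N) (g : Gal(L/K)) (x : L)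
    (w : MonoidAlgebra (Integers p L) N) :
    g (actAt 1 x w) = actAt g x (galoisAction p hN g w) := by
  induction w using MonoidAlgebra.induction_linear with
  | zero => simp
  | add a b ha hb => rw [map_add, map_add, ha, hb, map_add, map_add]
  | single μ d =>
    rw [galoisAction_single, actAt_single, actAt_single, coe_conj, map_mul,
      integralClosure.coe_smul, AlgEquiv.smul_def]
    simp [mul_inv_rev, Equiv.Perm.mul_apply, AlgEquiv.mul_apply]

theorem act_mul (hN : IsTranslationNormalized N) (z w : MonoidAlgebra (Integers p L) N)
    (hw : w ∈ fixedOrder p hN) (x : L) : act (z * w) x = act z (act w x) := by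
  simp only [act_eq]
  induction z using MonoidAlgebra.induction_linear with
  | zero => simp
  | add a b ha hb => rw [add_mul, map_add, ha, hb, map_add]
  | single η c => rw [actAt_single_mul, actAt_single, gal_actAt hN, hw]

variable [Algebra ℚ_[p] K] [Algebra ℚ_[p] L] [IsScalarTower ℚ_[p] K L]
  [IsScalarTower ℤ_[p] ℚ_[p] L] [FiniteDimensional ℚ_[p] L]

/-- A fractional ideal of `L`, or more generally any `𝔒_L`-submodule of `L`, is acted on by
`Λ^G = 𝔒_L[N]^G` through `(∑ c_η η) · x = ∑ c_η η⁻¹(1)[x]`. -/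
instance fixedOrderSMul (hN : IsTranslationNormalized N) (I : Submodule (Integers p L) L) :
    SMul (fixedOrder p hN) I where
  smul z x := ⟨act z.1 x.1, act_mem I z.1 x.2⟩

theorem coe_fixedOrder_smul (hN : IsTranslationNormalized N) (I : Submodule (Integers p L) L)
    (z : fixedOrder p hN) (x : I) : ((z • x : I) : L) = act z.1 x.1 :=
  rfl

/-- This action makes every fractional ideal a `Λ^G`-module. -/
instance fixedOrderModule (hN : IsTranslationNormalized N) (I : Submodule (Integers p L) L) :
    Module (fixedOrder p hN) I where
  one_smul x := Subtype.ext <| by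
    rw [coe_fixedOrder_smul, OneMemClass.coe_one, act_eq, MonoidAlgebra.one_def, actAt_single]
    simp
  mul_smul z w x := Subtype.ext <| act_mul hN z.1 w.1 w.2 x.1
  smul_zero z := Subtype.ext <| act_zero_right z.1
  smul_add z x y := Subtype.ext <| act_add_right z.1 x.1 y.1
  add_smul z w x := Subtype.ext <| map_add (actAt 1 x.1) z.1 w.1
  zero_smul x := Subtype.ext <| by
    rw [coe_fixedOrder_smul, ZeroMemClass.coe_zero, act_eq, map_zero, ZeroMemClass.coe_zero]

end Order

end PadicHopfGalois

end

/-! Write Λ = 𝔒_L[N], A = Λ^G, n = |G| and κ(η) = η(1), a bijection N → G by regularity. A is finite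
over ℤ_p, hence semilocal, and a finite flat module of rank 1 at every prime of a semilocal ring is
free. So it suffices that a nonzero fractional ideal 𝔅 = b𝔒_L is finite and flat over A, and that
A^n and 𝔅^n embed in each other (`free_of_injective`).

𝔅 is a retract of Λ (`exists_embedding`, `exists_projection`): x ↦ ∑ b⁻¹κ(η)(x) η is A-linear, and z
↦ ∑ κ(η)⁻¹(b c z_η) retracts it when c in 𝔒_L has trace 1. Tameness provides c
(`exists_sum_smul_eq_one`). The two embeddings pass through Λ and use integers ω i of L for which
the matrix (g(ω i)) is invertible (`free_of_principal`).

What remains is that Λ is flat over A (`flat_over_fixedGroupRing`). Split N = P × Q into its p-part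
and its prime-to-p part. As |Q| is a unit, 𝔒_L[Q] is integrally closed in L[Q]. Hence R =
𝔒_L[Q]^{G₀} is the integral closure of ℤ_p in the reduced algebra L[Q]^{G₀}, a finite product of
Dedekind domains, and the torsion-free module 𝔒_L[Q] is flat over it (`flat_of_mem_iff`). Since G₀
acts trivially on P, Λ^{G₀} = R[P], and Λ = 𝔒_L[Q][P] is flat over it. Finally Λ^{G₀} is projective
over Λ^G by Galois descent (`projective_of_galois`), because the extension is unramified above
inertia and |G₀| is a unit (`exists_galois_elements`). -/

noncomputable section

namespace PadicHopfGalois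

set_option linter.unusedSectionVars false

/-! ### Ranks and freeness over semilocal rings -/

section Semilocal

/-- Localization is exact, and ranks over the local ring at `q` are monotone under injections. -/
theorem rankAtStalk_le_of_injective {A : Type*} [CommRing A] {M M' : Type*} [AddCommGroup M]
    [Module A M] [AddCommGroup M'] [Module A M'] [Module.Finite A M] [Module.Flat A M]
    [Module.Finite A M'] [Module.Flat A M'] (f : M →ₗ[A] M') (hf : Function.Injective f)
    (q : PrimeSpectrum A) :
    Module.rankAtStalk (R := A) M q ≤ Module.rankAtStalk (R := A) M' q := by
  have h := LocalizedModule.map_injective q.asIdeal.primeCompl f hf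
  rw [Module.rankAtStalk, Module.rankAtStalk]
  exact LinearMap.finrank_le_finrank_of_injective h

/-- A finite flat module over a semilocal ring, some power of which embeds into the same power of
the ring and conversely, is free. -/
theorem free_of_injective {A : Type*} [CommRing A] [Finite (MaximalSpectrum A)] {M : Type*}
    [AddCommGroup M] [Module A M] [Module.Finite A M] [Module.Flat A M] {ι : Type*} [Finite ι]
    [Nonempty ι] (f : (ι → A) →ₗ[A] (ι → M)) (hf : Function.Injective f)
    (g : (ι → M) →ₗ[A] (ι → A)) (hg : Function.Injective g) : Module.Free A M := by
  classical
  have := Fintype.ofFinite ι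
  have : Module.Flat A (ι → M) :=
    Module.Flat.of_linearEquiv (DirectSum.linearEquivFunOnFintype A ι fun _ => M).symm
  have rk : ∀ q : PrimeSpectrum A, Module.rankAtStalk (R := A) M q = 1 := by
    intro q
    have : Nontrivial A := q.nontrivial
    -- With n = |ι| and r the rank of `M` at `q`, the two embeddings give n ≤ nr ≤ n, so r = 1.
    have h1 := rankAtStalk_le_of_injective f hf q
    have h2 := rankAtStalk_le_of_injective g hg q
    have h3 : Module.rankAtStalk (R := A) (ι → A) q = Nat.card ι := by
      rw [Module.rankAtStalk_pi]
      simp [finsum_eq_sum_of_fintype]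
    have h4 : Module.rankAtStalk (R := A) (ι → M) q =
        Nat.card ι * Module.rankAtStalk (R := A) M q := by
      rw [Module.rankAtStalk_pi]
      simp [finsum_eq_sum_of_fintype]
    rw [h3, h4] at h1 h2
    have := Nat.card_pos (α := ι)
    exact (mul_eq_left₀ this.ne').1 (le_antisymm h2 h1)
  refine Module.free_of_flat_of_finrank_eq A M 1 fun P => ?_
  let := Ideal.Quotient.field P.1
  have h := Module.rankAtStalk_baseChange (R := A) (M := M) (S := A ⧸ P.1) ⊥
  rw [rk, Module.rankAtStalk_eq_finrank_of_free] at h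
  simpa using h

/-- A finite algebra over a local ring is semilocal. -/
theorem finite_maximalSpectrum (R A : Type*) [CommRing R] [IsLocalRing R] [CommRing A]
    [Algebra R A] [Module.Finite R A] : Finite (MaximalSpectrum A) := by
  have h := Algebra.QuasiFinite.finite_primesOver (S := A) (IsLocalRing.maximalIdeal R)
  have := h.to_subtype
  refine Finite.of_injective (β := (IsLocalRing.maximalIdeal R).primesOver A)
    (fun P => ⟨P.1, P.2.isPrime, ⟨?_⟩⟩) ?_
  · have := P.2
    exact (IsLocalRing.eq_maximalIdeal (Ideal.IsMaximal.under R P.1)).symm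
  · intro P Q h
    exact MaximalSpectrum.ext (congrArg Subtype.val h)

end Semilocal

/-! ### Traces and Galois descent -/

section Trace

variable {A Λ Γ : Type*} [CommRing A] [CommRing Λ] [Algebra A Λ] [Group Γ]

/-- The trace `z ↦ ∑ γ(z)` of a finite group of automorphisms of `Λ` with fixed ring `A`. -/
theorem exists_trace (ρ : Γ →* (Λ →+* Λ)) (hinj : Function.Injective (algebraMap A Λ))
    (hfix : ∀ z : Λ, (∀ γ, ρ γ z = z) ↔ z ∈ (algebraMap A Λ).range) [Fintype Γ] :
    ∃ tr : Λ →ₗ[A] A, ∀ z, algebraMap A Λ (tr z) = ∑ γ, ρ γ z := by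
  have h : ∀ z, ∃ a, algebraMap A Λ a = ∑ γ, ρ γ z := by
    intro z
    refine RingHom.mem_range.1 ((hfix _).1 fun γ => ?_)
    rw [map_sum]
    refine Fintype.sum_equiv (Equiv.mulLeft γ) _ _ fun δ => ?_
    rw [Equiv.coe_mulLeft, map_mul]
    rfl
  choose tr htr using h
  refine ⟨⟨⟨tr, fun x y => hinj ?_⟩, fun a x => hinj ?_⟩, htr⟩
  · rw [map_add, htr, htr, htr, ← Finset.sum_add_distrib]
    exact Finset.sum_congr rfl fun γ _ => map_add _ _ _
  · rw [htr, RingHom.id_apply, smul_eq_mul, map_mul, htr, Finset.mul_sum]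
    refine Finset.sum_congr rfl fun γ _ => ?_
    rw [Algebra.smul_def, map_mul, (hfix _).2 ⟨a, rfl⟩ γ]

/-- If the fixed ring `Λ₀` of a subgroup `Γ₀` of `Γ` contains `c k`, `μ k` with
`|Γ₀| ∑ γ(c k) μ k` equal to `1` for `γ ∈ Γ₀` and to `0` otherwise, then `Λ₀` is finite and
projective over the fixed ring of `Γ`. -/
theorem projective_of_galois [Finite Γ] {Λ₀ : Type*} [CommRing Λ₀] [Algebra Λ₀ Λ] [Algebra A Λ₀]
    [IsScalarTower A Λ₀ Λ] (ρ : Γ →* (Λ →+* Λ)) (hinj : Function.Injective (algebraMap A Λ))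
    (hfix : ∀ z : Λ, (∀ γ, ρ γ z = z) ↔ z ∈ (algebraMap A Λ).range)
    (Γ₀ : Subgroup Γ) (hinj₀ : Function.Injective (algebraMap Λ₀ Λ))
    (hfix₀ : ∀ z : Λ, (∀ γ ∈ Γ₀, ρ γ z = z) ↔ z ∈ (algebraMap Λ₀ Λ).range)
    {ι : Type*} [Fintype ι] (c μ : ι → Λ) (hμ : ∀ k, ∀ γ ∈ Γ₀, ρ γ (μ k) = μ k)
    (h1 : ∀ γ ∈ Γ₀, Nat.card Γ₀ * ∑ k, ρ γ (c k) * μ k = 1)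
    (h0 : ∀ γ ∉ Γ₀, ∑ k, ρ γ (c k) * μ k = 0) :
    Module.Finite A Λ₀ ∧ Module.Projective A Λ₀ := by
  classical
  have := Fintype.ofFinite Γ
  obtain ⟨tr, htr⟩ := exists_trace ρ hinj hfix
  have hμ' : ∀ k, ∃ m : Λ₀, algebraMap Λ₀ Λ m = μ k := fun k => (hfix₀ _).1 (hμ k)
  choose m hm using hμ'
  -- The functionals w ↦ tr(c k · w) and the elements μ k form a dual basis: in ∑ tr(c k · w) μ k
  -- the terms with γ outside Γ₀ vanish, and each γ in Γ₀ contributes w/|Γ₀|.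
  let i : Λ₀ →ₗ[A] (ι → A) := LinearMap.pi fun k =>
    tr ∘ₗ (LinearMap.mulLeft A (c k)) ∘ₗ (IsScalarTower.toAlgHom A Λ₀ Λ).toLinearMap
  let s : (ι → A) →ₗ[A] Λ₀ := Fintype.linearCombination A m
  have hs : s ∘ₗ i = LinearMap.id := by
    refine LinearMap.ext fun w => hinj₀ ?_
    have hw : ∀ γ ∈ Γ₀, ρ γ (algebraMap Λ₀ Λ w) = algebraMap Λ₀ Λ w := (hfix₀ _).2 ⟨w, rfl⟩
    have : algebraMap Λ₀ Λ (s (i w)) =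
        ∑ γ, ρ γ (algebraMap Λ₀ Λ w) * ∑ k, ρ γ (c k) * μ k := by
      simp only [s, i, Fintype.linearCombination_apply, map_sum, Algebra.smul_def, map_mul,
        ← IsScalarTower.algebraMap_apply, hm, LinearMap.pi_apply, LinearMap.comp_apply, htr,
        LinearMap.mulLeft_apply, AlgHom.toLinearMap_apply, IsScalarTower.coe_toAlgHom',
        Finset.sum_mul, Finset.mul_sum]
      rw [Finset.sum_comm]
      exact Finset.sum_congr rfl fun γ _ => Finset.sum_congr rfl fun k _ => by ring
    rw [LinearMap.comp_apply, this, LinearMap.id_apply]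
    rw [← Finset.sum_filter_add_sum_filter_not Finset.univ (fun γ => γ ∈ Γ₀),
      Finset.sum_congr rfl fun γ hγ => by rw [hw γ (Finset.mem_filter.1 hγ).2],
      Finset.sum_congr (s₁ := Finset.univ.filter (· ∉ Γ₀)) rfl fun γ hγ => by
        rw [h0 γ (Finset.mem_filter.1 hγ).2, mul_zero],
      Finset.sum_const_zero, add_zero, ← Finset.mul_sum]
    have h1' : (∑ γ with γ ∈ Γ₀, ∑ k, ρ γ (c k) * μ k) = 1 := by
      have h1m := h1 1 Γ₀.one_mem
      have hu : IsUnit ((Nat.card Γ₀ : ℕ) : Λ) := IsUnit.of_mul_eq_one _ h1m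
      rw [Finset.sum_congr rfl (g := fun _ => ∑ k, ρ 1 (c k) * μ k), Finset.sum_const,
        nsmul_eq_mul]
      · convert h1m
        rw [Nat.card_eq_fintype_card, Fintype.card_subtype]
      · intro γ hγ
        exact hu.mul_left_cancel ((h1 γ (Finset.mem_filter.1 hγ).2).trans h1m.symm)
    rw [h1', mul_one]
  exact ⟨Module.Finite.of_surjective s fun x => ⟨i x, LinearMap.congr_fun hs x⟩,
    Module.Projective.of_split i s hs⟩

end Trace

/-! ### Flatness of group rings under change of coefficients -/

section GroupRing

open scoped AlgebraMonoidAlgebra in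
/-- If `S` is flat over `R`, then so is `S[P]` over `R[P]`. -/
theorem flat_mapRingHom {R S P : Type*} [CommRing R] [CommRing S] [Algebra R S] [CommMonoid P]
    [Module.Flat R S] : (MonoidAlgebra.mapRingHom P (algebraMap R S)).Flat := by
  have h : Algebra.IsPushout R S R S := inferInstance
  have h' : Algebra.IsPushout R S (MonoidAlgebra R P) (MonoidAlgebra S P) := inferInstance
  have := h'.symm
  exact Module.Flat.isBaseChange R (MonoidAlgebra R P) S (MonoidAlgebra S P) this.out

end GroupRing

/-! ### Torsion-free modules over products of Dedekind domains -/

section Lattice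

open TensorProduct

/-- If `R` is the product of the rings `D i`, a module is flat as soon as its components are. -/
theorem flat_of_components {R M ι : Type*} [CommRing R] [AddCommGroup M] [Module R M] [Fintype ι]
    (D : ι → Type*) [∀ i, CommRing (D i)] [∀ i, Algebra R (D i)] (σ : ∀ i, D i →ₗ[R] R)
    (hσ : ∀ r, ∑ i, σ i (algebraMap R (D i) r) = r)
    (hD : ∀ i, Module.Flat R (D i)) (h : ∀ i, Module.Flat (D i) (D i ⊗[R] M)) :
    Module.Flat R M := by
  classical
  have h' : ∀ i, Module.Flat R (D i ⊗[R] M) := fun i =>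
    have := hD i
    have := h i
    Module.Flat.trans R (D i) (D i ⊗[R] M)
  have : Module.Flat R (∀ i, D i ⊗[R] M) :=
    Module.Flat.of_linearEquiv (DirectSum.linearEquivFunOnFintype R ι fun i => D i ⊗[R] M).symm
  let i : M →ₗ[R] ∀ i, D i ⊗[R] M := LinearMap.pi fun i => TensorProduct.mk R (D i) M 1
  let s : (∀ i, D i ⊗[R] M) →ₗ[R] M :=
    ∑ i, (TensorProduct.lid R M).toLinearMap ∘ₗ (σ i).rTensor M ∘ₗ LinearMap.proj i
  refine Module.Flat.of_retract i s (LinearMap.ext fun m => ?_)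
  simp only [i, s, LinearMap.comp_apply, LinearMap.sum_apply, LinearMap.pi_apply,
    LinearMap.proj_apply, TensorProduct.mk_apply, LinearMap.rTensor_tmul, LinearEquiv.coe_coe,
    TensorProduct.lid_tmul, LinearMap.id_apply]
  rw [← Finset.sum_smul]
  simpa using congrArg (· • m) (hσ 1)

/-- Let `D` be a Dedekind domain integral over `Z`. The base change to `D` of a `Z`-torsion-free
module along a flat map `R → D` is flat. -/
theorem flat_baseChange_of_torsionFree {Z R D M : Type*} [CommRing Z] [IsDomain Z] [CommRing R]
    [CommRing D] [Algebra Z R] [Algebra R D] [Algebra Z D] [IsScalarTower Z R D]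
    [IsDedekindDomain D] [Algebra.IsIntegral Z D] [AddCommGroup M]
    [Module R M] [Module.Flat R D]
    (hM : ∀ (z : Z) (m : M), z ≠ 0 → algebraMap Z R z • m = 0 → m = 0) :
    Module.Flat D (D ⊗[R] M) := by
  have hz : ∀ (z : Z) (x : D ⊗[R] M), z ≠ 0 → algebraMap Z D z • x = 0 → x = 0 := by
    intro z x hz hx
    have h1 : Function.Injective (LinearMap.lsmul R M (algebraMap Z R z)) :=
      (injective_iff_map_eq_zero _).2 fun m hm => hM z m hz hm
    have h2 := Module.Flat.lTensor_preserves_injective_linearMap (M := D) _ h1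
    refine (injective_iff_map_eq_zero _).1 h2 x ?_
    rw [← hx]
    clear hx
    induction x with
    | zero => simp
    | add x y hx hy => rw [map_add, hx, hy, smul_add]
    | tmul d m =>
      rw [LinearMap.lTensor_tmul, LinearMap.lsmul_apply, TensorProduct.tmul_smul,
        TensorProduct.smul_tmul', TensorProduct.smul_tmul', IsScalarTower.algebraMap_apply Z R D,
        Algebra.smul_def (algebraMap Z R z) d, smul_eq_mul]
  have : Module.IsTorsionFree D (D ⊗[R] M) := by
    refine ⟨fun d hd => ?_⟩
    refine (injective_iff_map_eq_zero (DistribSMul.toAddMonoidHom (D ⊗[R] M) d)).2 fun x hx => ?_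
    -- A nonzero element of `D`, being integral over `Z`, divides a nonzero element of `Z`, so
    -- `Z`-torsion-freeness gives `D`-torsion-freeness; over a Dedekind domain this is flatness.
    obtain ⟨z, hz0, d', hd'⟩ :=
      ((Algebra.IsIntegral.isIntegral (R := Z) d).isAlgebraic).exists_nonzero_dvd hd.mem_nonZeroDivisors
    refine hz z x hz0 ?_
    rw [hd', mul_comm, mul_smul]
    exact (congrArg (d' • ·) hx).trans (smul_zero _)
  infer_instance

/-- Let `R` be the integral closure of a Dedekind domain `Z` in a finite reduced algebra over its
fraction field, of characteristic zero. Then every `Z`-torsion-free `R`-module is flat. -/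
theorem flat_of_torsionFree (Z k F : Type*) {R M : Type*} [CommRing Z] [IsDedekindDomain Z] [Field k]
    [CharZero k] [Algebra Z k] [IsFractionRing Z k] [CommRing F] [IsReduced F] [Algebra k F]
    [Algebra Z F] [IsScalarTower Z k F] [FiniteDimensional k F] [CommRing R] [Algebra Z R]
    [Algebra R F] [IsScalarTower Z R F] [IsIntegralClosure R Z F] [AddCommGroup M] [Module R M]
    (hM : ∀ (z : Z) (m : M), z ≠ 0 → algebraMap Z R z • m = 0 → m = 0) : Module.Flat R M := by
  classical
  have : IsArtinianRing F := IsArtinianRing.of_finite k F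
  have := Fintype.ofFinite (MaximalSpectrum F)
  let _ : ∀ I : MaximalSpectrum F, Field (F ⧸ I.asIdeal) := fun I => Ideal.Quotient.field I.asIdeal
  -- The Artinian reduced ring `F` is the product of its residue fields, and `R` is the product of
  -- the integral closures of `Z` in them.
  let D : MaximalSpectrum F → Type _ := fun I => integralClosure Z (F ⧸ I.asIdeal)
  let φ : ∀ I, R →ₐ[Z] D I := fun I =>
    ((Ideal.Quotient.mkₐ Z I.asIdeal).comp (IsScalarTower.toAlgHom Z R F)).codRestrict _
      fun r => (IsIntegralClosure.isIntegral Z F r).map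
        ((Ideal.Quotient.mkₐ Z I.asIdeal).comp (IsScalarTower.toAlgHom Z R F))
  let _ : ∀ I, Algebra R (D I) := fun I => (φ I).toRingHom.toAlgebra
  have hφ : ∀ I r, ((algebraMap R (D I) r : D I) : F ⧸ I.asIdeal) =
      Ideal.Quotient.mk I.asIdeal (algebraMap R F r) := fun I r => rfl
  have hext : ∀ x y : F, (∀ I : MaximalSpectrum F,
      Ideal.Quotient.mk I.asIdeal x = Ideal.Quotient.mk I.asIdeal y) → x = y :=
    fun x y h => (IsArtinianRing.equivPi F).injective (funext h)
  have hR : Function.Injective (algebraMap R F) := IsIntegralClosure.algebraMap_injective R Z F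
  have hlift : ∀ I (d : D I), ∃ r : R, Ideal.Quotient.mk I.asIdeal (algebraMap R F r) = d.1 ∧
      ∀ J : MaximalSpectrum F, J ≠ I → Ideal.Quotient.mk J.asIdeal (algebraMap R F r) = 0 := by
    intro I d
    obtain ⟨x, hx⟩ := (IsArtinianRing.equivPi F).surjective (Pi.single I d.1)
    have hx1 : Ideal.Quotient.mk I.asIdeal x = d.1 := by
      have := congrFun hx I
      rwa [Pi.single_eq_same] at this
    have hx0 : ∀ J : MaximalSpectrum F, J ≠ I → Ideal.Quotient.mk J.asIdeal x = 0 := by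
      intro J hJ
      have := congrFun hx J
      rwa [Pi.single_eq_of_ne hJ] at this
    obtain ⟨f, hf, hfd⟩ := d.2
    -- If f kills d, then X·f kills the element with component d at `I` and 0 elsewhere; the factor
    -- X takes care of the zero components.
    have hint : IsIntegral Z x := by
      refine ⟨Polynomial.X * f, Polynomial.monic_X.mul hf, ?_⟩
      rw [Polynomial.eval₂_mul, Polynomial.eval₂_X]
      refine hext _ _ fun J => ?_
      rw [map_mul, map_zero]
      by_cases hJ : J = I
      · subst hJ
        rw [Polynomial.hom_eval₂, hx1]
        exact mul_eq_zero_of_right _ hfd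
      · rw [hx0 J hJ, zero_mul]
    obtain ⟨r, rfl⟩ := IsIntegralClosure.isIntegral_iff (A := R) (B := F).1 hint
    exact ⟨r, hx1, hx0⟩
  choose σ hσ1 hσ0 using hlift
  have hext' : ∀ r s : R, (∀ I : MaximalSpectrum F, Ideal.Quotient.mk I.asIdeal
      (algebraMap R F r) = Ideal.Quotient.mk I.asIdeal (algebraMap R F s)) → r = s :=
    fun r s h => hR (hext _ _ h)
  let σl : ∀ I, D I →ₗ[R] R := fun I =>
    { toFun := σ I
      map_add' := fun x y => hext' _ _ fun J => by
        by_cases hJ : J = I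
        · subst hJ
          rw [map_add, map_add, hσ1, hσ1, hσ1]
          rfl
        · rw [map_add, map_add, hσ0 _ _ _ hJ, hσ0 _ _ _ hJ, hσ0 _ _ _ hJ, add_zero]
      map_smul' := fun r x => hext' _ _ fun J => by
        by_cases hJ : J = I
        · subst hJ
          rw [RingHom.id_apply, smul_eq_mul, map_mul, map_mul, hσ1, hσ1, ← hφ]
          rfl
        · rw [RingHom.id_apply, smul_eq_mul, map_mul, map_mul, hσ0 _ _ _ hJ, hσ0 _ _ _ hJ,
            mul_zero] }
  have hid : ∀ I (d : D I), algebraMap R (D I) (σ I d) = d := fun I d => Subtype.ext (hσ1 I d)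
  refine flat_of_components D σl (fun r => hext' _ _ fun J => ?_) (fun I => ?_) fun I => ?_
  · rw [map_sum, map_sum, Finset.sum_eq_single J]
    · exact hσ1 J _
    · intro I _ hI
      exact hσ0 _ _ _ hI.symm
    · simp
  · exact Module.Flat.of_retract (σl I) (Algebra.linearMap R (D I)) (LinearMap.ext (hid I))
  · have : Module.Flat R (D I) :=
      Module.Flat.of_retract (σl I) (Algebra.linearMap R (D I)) (LinearMap.ext (hid I))
    have : IsScalarTower Z R (D I) := IsScalarTower.of_algebraMap_eq fun z => by
      exact ((φ I).commutes z).symm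
    have : IsDedekindDomain (D I) := integralClosure.isDedekindDomain Z k (F ⧸ I.asIdeal)
    have : Algebra.IsIntegral Z (D I) := integralClosure.AlgebraIsIntegral
    exact flat_baseChange_of_torsionFree hM

end Lattice

/-! ### Integral closedness of O[Q] when |Q| is invertible -/

section IntegrallyClosed

theorem coeff_mapRingHom {R S Q : Type*} [CommRing R] [CommRing S] [CommGroup Q] (f : R →+* S)
    (w : MonoidAlgebra R Q) (q : Q) :
    (MonoidAlgebra.mapRingHom Q f w).coeff q = f (w.coeff q) := by
  simp

theorem coeff_ext {R Q : Type*} [CommRing R] {x y : MonoidAlgebra R Q}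
    (h : ∀ q, x.coeff q = y.coeff q) : x = y :=
  MonoidAlgebra.ext (Finsupp.ext h)

theorem mapRingHom_injective {R S Q : Type*} [CommRing R] [CommRing S] [CommGroup Q] (f : R →+* S)
    (hf : Function.Injective f) : Function.Injective (MonoidAlgebra.mapRingHom Q f) := by
  intro x y h
  refine coeff_ext fun q => hf ?_
  rw [← coeff_mapRingHom, ← coeff_mapRingHom, h]

variable {O L Q : Type*} [CommRing O] [IsDomain O] [IsDiscreteValuationRing O] [Field L]
  [Algebra O L] [IsFractionRing O L] [CommGroup Q] [Finite Q]

/-- If `z π^(k+1)` is in `O[Q]` for an integral `z` in `L[Q]`, then it is divisible by `π`. -/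
theorem dvd_of_isIntegral (hQ : IsUnit (Nat.card Q : O)) {π : O} (hπ : Irreducible π) (k : ℕ)
    {z : MonoidAlgebra L Q} (hz : IsIntegral O z) {w : MonoidAlgebra O Q}
    (hw : MonoidAlgebra.mapRingHom Q (algebraMap O L) w = algebraMap O _ (π ^ (k + 1)) * z) :
    ∃ w', w = algebraMap O _ π * w' := by
  obtain ⟨f, hf, hfz⟩ := hz
  let κ := IsLocalRing.ResidueField O
  -- Since |Q| is nonzero in the residue field, κ[Q] is reduced, so the nilpotent reduction of `w`
  -- will vanish.
  have : NeZero (Nat.card Q : κ) := ⟨by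
    have := hQ.map (IsLocalRing.residue O)
    rw [map_natCast] at this
    exact this.ne_zero⟩
  have hinj := mapRingHom_injective (Q := Q) (algebraMap O L) (IsFractionRing.injective O L)
  have hcomp : (MonoidAlgebra.mapRingHom Q (algebraMap O L)).comp
      (algebraMap O (MonoidAlgebra O Q)) = algebraMap O (MonoidAlgebra L Q) := by
    ext x q
    simp
  -- Scaling the roots of f by π^(k+1) gives a monic polynomial over `O` that kills `w` and reduces
  -- to a power of X modulo π.
  have h1 : (f.scaleRoots (π ^ (k + 1))).eval₂ (algebraMap O (MonoidAlgebra O Q)) w = 0 := by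
    apply hinj
    rw [Polynomial.hom_eval₂, hw, map_zero, hcomp]
    exact Polynomial.scaleRoots_eval₂_eq_zero _ hfz
  have h2 := congrArg (MonoidAlgebra.mapRingHom Q (IsLocalRing.residue O)) h1
  have hcomp' : (MonoidAlgebra.mapRingHom Q (IsLocalRing.residue O)).comp
      (algebraMap O (MonoidAlgebra O Q)) =
      (algebraMap κ (MonoidAlgebra κ Q)).comp (IsLocalRing.residue O) := by
    ext x q
    simp
  have hπ0 : IsLocalRing.residue O (π ^ (k + 1)) = 0 := by
    rw [IsLocalRing.residue_eq_zero_iff]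
    exact Ideal.pow_mem_of_mem _ ((IsLocalRing.mem_maximalIdeal _).2 hπ.not_isUnit) _
      (Nat.succ_pos k)
  rw [map_zero, Polynomial.hom_eval₂, hcomp', ← Polynomial.eval₂_map,
    Polynomial.map_scaleRoots _ _ _ (by rw [hf.leadingCoeff]; simp), hπ0,
    Polynomial.scaleRoots_zero, (hf.map _).leadingCoeff, one_smul, Polynomial.eval₂_X_pow] at h2
  have h3 := eq_zero_of_pow_eq_zero h2
  have h4 : ∀ q, ∃ c, w.coeff q = π * c := by
    intro q
    have := congrArg (fun x => x.coeff q) h3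
    simp only [coeff_mapRingHom] at this
    have h5 : IsLocalRing.residue O (w.coeff q) = 0 := this
    rw [IsLocalRing.residue_eq_zero_iff, hπ.maximalIdeal_eq, Ideal.mem_span_singleton] at h5
    exact h5
  choose c hc using h4
  have := Fintype.ofFinite Q
  refine ⟨∑ q, MonoidAlgebra.single q (c q), coeff_ext fun q => ?_⟩
  classical
  rw [hc, ← Algebra.smul_def]
  simp [MonoidAlgebra.coeff_single, Finsupp.single_apply]

/-- If the order of `Q` is invertible in the discrete valuation ring `O`, then `O[Q]` is
integrally closed in `L[Q]`. -/
theorem exists_eq_mapRingHom_of_isIntegral (hQ : IsUnit (Nat.card Q : O))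
    {z : MonoidAlgebra L Q} (hz : IsIntegral O z) :
    ∃ w : MonoidAlgebra O Q, MonoidAlgebra.mapRingHom Q (algebraMap O L) w = z := by
  classical
  have := Fintype.ofFinite Q
  obtain ⟨π, hπ⟩ := IsDiscreteValuationRing.exists_irreducible O
  have key : ∀ (k : ℕ) (w : MonoidAlgebra O Q),
      MonoidAlgebra.mapRingHom Q (algebraMap O L) w = algebraMap O _ (π ^ k) * z →
      ∃ w : MonoidAlgebra O Q, MonoidAlgebra.mapRingHom Q (algebraMap O L) w = z := by
    intro k
    induction k with
    | zero => exact fun w hw => ⟨w, by rwa [pow_zero, map_one, one_mul] at hw⟩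
    | succ k ih =>
      intro w hw
      obtain ⟨w', rfl⟩ := dvd_of_isIntegral hQ hπ k hz hw
      refine ih w' (coeff_ext fun q => ?_)
      have := congrArg (fun x => x.coeff q) hw
      rw [← Algebra.smul_def, ← Algebra.smul_def] at this
      simp only [coeff_mapRingHom, MonoidAlgebra.coeff_smul, Finsupp.smul_apply, smul_eq_mul,
        map_mul, pow_succ', mul_smul] at this
      rw [coeff_mapRingHom, ← Algebra.smul_def, MonoidAlgebra.coeff_smul, Finsupp.smul_apply]
      rw [Algebra.smul_def π] at this
      exact mul_left_cancel₀ ((map_ne_zero_iff _ (IsFractionRing.injective O L)).2 hπ.ne_zero) this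
  obtain ⟨d, hd⟩ := IsLocalization.exist_integer_multiples_of_finset (nonZeroDivisors O)
    (Finset.univ.image fun q => z.coeff q)
  have hd' : ∀ q, ∃ c : O, algebraMap O L c = (d : O) • z.coeff q := fun q =>
    hd _ (Finset.mem_image_of_mem _ (Finset.mem_univ q))
  choose c hc using hd'
  -- The common denominator is u π^k, so π^k z has coefficients in `O`; `key` then removes the
  -- factors π one at a time.
  obtain ⟨k, u, hu⟩ := IsDiscreteValuationRing.eq_unit_mul_pow_irreducible
    (nonZeroDivisors.coe_ne_zero d) hπ
  refine key k (∑ q, MonoidAlgebra.single q ((u⁻¹ : Oˣ) * c q)) (coeff_ext fun q => ?_)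
  rw [coeff_mapRingHom, ← Algebra.smul_def]
  have h5 : (∑ q, MonoidAlgebra.single q ((u⁻¹ : Oˣ) * c q) : MonoidAlgebra O Q).coeff q =
      (u⁻¹ : Oˣ) * c q := by
    simp [MonoidAlgebra.coeff_single, Finsupp.single_apply]
  rw [h5, map_mul, hc, hu, mul_smul, Algebra.smul_def (u : O), ← mul_assoc, ← map_mul,
    Units.inv_mul, map_one, one_mul]
  rfl

/-- Let `F` be a subalgebra of `L[Q]` and `R` its intersection with `O[Q]`. If the order of `Q` is
invertible in `O`, then `O[Q]` is flat over `R`. -/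
theorem flat_of_mem_iff {Z k : Type*} [CommRing Z] [IsDedekindDomain Z] [Field k] [CharZero k]
    [Algebra Z k] [IsFractionRing Z k] [Algebra Z O] [Module.Finite Z O]
    [FaithfulSMul Z O] [Algebra Z L] [IsScalarTower Z O L]
    [Algebra k L] [FiniteDimensional k L] [IsScalarTower Z k L] (hQ : IsUnit (Nat.card Q : O))
    (F : Subalgebra k (MonoidAlgebra L Q)) (R : Subalgebra Z (MonoidAlgebra O Q))
    (hRF : ∀ w, w ∈ R ↔ MonoidAlgebra.mapRingHom Q (algebraMap O L) w ∈ F) :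
    Module.Flat R (MonoidAlgebra O Q) := by
  let φ : MonoidAlgebra O Q →+* MonoidAlgebra L Q := MonoidAlgebra.mapRingHom Q (algebraMap O L)
  have hφ : Function.Injective φ := mapRingHom_injective _ (IsFractionRing.injective O L)
  have hφZ : ∀ z : Z, φ (algebraMap Z _ z) = algebraMap Z _ z := by
    intro z
    refine coeff_ext fun q => ?_
    simp [φ, ← IsScalarTower.algebraMap_apply]
  let _ : Algebra R F := RingHom.toAlgebra
    { toFun := fun r => ⟨φ r.1, (hRF _).1 r.2⟩
      map_one' := Subtype.ext (map_one φ)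
      map_zero' := Subtype.ext (map_zero φ)
      map_mul' := fun _ _ => Subtype.ext (map_mul φ _ _)
      map_add' := fun _ _ => Subtype.ext (map_add φ _ _) }
  have : CharZero L := charZero_of_injective_algebraMap (algebraMap k L).injective
  have : NeZero (Nat.card Q : L) := ⟨Nat.cast_ne_zero.2 Nat.card_pos.ne'⟩
  have : Module.Finite L (MonoidAlgebra L Q) :=
    Module.Finite.equiv (MonoidAlgebra.coeffLinearEquiv (S := L) (M := Q) L).symm
  have : Module.Finite O (MonoidAlgebra O Q) :=
    Module.Finite.equiv (MonoidAlgebra.coeffLinearEquiv (S := O) (M := Q) O).symm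
  have : Module.Finite Z (MonoidAlgebra O Q) := Module.Finite.trans O _
  have : FiniteDimensional k (MonoidAlgebra L Q) := Module.Finite.trans L _
  -- L[Q] is reduced because |Q| is nonzero in `L`.
  have : IsReduced F := isReduced_of_injective F.subtype Subtype.val_injective
  have : IsScalarTower Z k F := IsScalarTower.of_algebraMap_eq fun z =>
    Subtype.ext (IsScalarTower.algebraMap_apply Z k (MonoidAlgebra L Q) z)
  have : IsScalarTower Z R F := IsScalarTower.of_algebraMap_eq fun z => Subtype.ext (hφZ z).symm
  have : IsIntegralClosure R Z F :=
    { algebraMap_injective := fun x y h => Subtype.ext (hφ (congrArg Subtype.val h))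
      isIntegral_iff := by
        intro x
        constructor
        · intro hx
          have hx1 : IsIntegral Z x.1 := hx.map (IsScalarTower.toAlgHom Z F (MonoidAlgebra L Q))
          obtain ⟨w, hw⟩ := exists_eq_mapRingHom_of_isIntegral hQ (hx1.tower_top (A := O))
          exact ⟨⟨w, (hRF w).2 (hw ▸ x.2)⟩, Subtype.ext hw⟩
        · rintro ⟨r, rfl⟩
          have h : IsIntegral Z r := by
            rw [← isIntegral_algebraMap_iff (A := R) (B := MonoidAlgebra O Q)
              Subtype.val_injective]
            exact Algebra.IsIntegral.isIntegral _
          exact h.map (IsScalarTower.toAlgHom Z R F) }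
  refine flat_of_torsionFree Z k F fun z m hz hm => coeff_ext fun q => ?_
  have := congrArg (fun x => x.coeff q) hm
  have h2 : z • m.coeff q = 0 := by
    rw [algebraMap_smul] at this
    exact this
  rw [Algebra.smul_def] at h2
  exact (mul_eq_zero.1 h2).resolve_left
    ((map_ne_zero_iff _ (FaithfulSMul.algebraMap_injective Z O)).2 hz)

end IntegrallyClosed

/-! ### Galois elements and trace one for tame actions -/

section Unramified

variable {O Γ : Type*} [CommRing O] [Group Γ] [MulSemiringAction Γ O]

theorem smul_mem_maximalIdeal [IsLocalRing O] (g : Γ) {x : O} (hx : x ∈ IsLocalRing.maximalIdeal O) :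
    g • x ∈ IsLocalRing.maximalIdeal O := by
  rw [IsLocalRing.mem_maximalIdeal, mem_nonunits_iff] at hx ⊢
  intro h
  apply hx
  have := h.map (MulSemiringAction.toRingHom Γ O g⁻¹)
  simpa using this

theorem smul_units_inv (g : Γ) (u : Oˣ) (h : g • (u : O) = u) :
    g • ((u⁻¹ : Oˣ) : O) = (u⁻¹ : Oˣ) := by
  have h2 : g • ((u⁻¹ : Oˣ) : O) * (g • (u : O)) = 1 := by
    rw [← smul_mul', Units.inv_mul, smul_one]
  rw [h] at h2
  exact (Units.inv_eq_of_mul_eq_one_left h2).symm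

/-- The elements fixed by a subgroup. -/
def fixedSubring (Γ₀ : Subgroup Γ) : Subring O where
  carrier := {x | ∀ h ∈ Γ₀, h • x = x}
  mul_mem' ha hb g hg := by rw [smul_mul', ha g hg, hb g hg]
  one_mem' g _ := smul_one _
  add_mem' ha hb g hg := by rw [smul_add, ha g hg, hb g hg]
  zero_mem' g _ := smul_zero _
  neg_mem' ha g hg := by rw [smul_neg, ha g hg]

/-- The functions `h ↦ ∑ h(c k) μ k` on `Γ`, with the `μ k` fixed by `Γ₀`, form a ring. -/
def separatingFunctions (Γ₀ : Subgroup Γ) :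
    TensorProduct ℤ (fixedSubring (O := O) Γ₀) O →ₐ[ℤ] (Γ → O) :=
  Algebra.TensorProduct.productMap
    ((Pi.constAlgHom ℤ Γ O).comp (fixedSubring (O := O) Γ₀).subtype.toIntAlgHom)
    (AlgHom.pi fun h => (MulSemiringAction.toRingHom Γ O h).toIntAlgHom)

theorem separatingFunctions_tmul (Γ₀ : Subgroup Γ) (μ : fixedSubring (O := O) Γ₀) (c : O) (h : Γ) :
    separatingFunctions Γ₀ (TensorProduct.tmul ℤ μ c) h = μ.1 * h • c := by
  rw [separatingFunctions, Algebra.TensorProduct.productMap_apply_tmul]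
  rfl

/-- If `Γ₀` is the inertia group and its order is invertible, the fixed ring of `Γ₀` is a Galois
extension of that of `Γ`. -/
theorem exists_galois_elements [IsLocalRing O] [Finite Γ] (Γ₀ : Subgroup Γ)
    (hΓ₀ : ∀ g, g ∈ Γ₀ ↔ ∀ x : O, g • x - x ∈ IsLocalRing.maximalIdeal O)
    (hcard : IsUnit (Nat.card Γ₀ : O)) :
    ∃ (s : Finset (O × O)), (∀ x ∈ s, ∀ h ∈ Γ₀, h • x.2 = x.2) ∧
      (∀ g ∈ Γ₀, Nat.card Γ₀ * ∑ x ∈ s, g • x.1 * x.2 = 1) ∧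
      (∀ g ∉ Γ₀, ∑ x ∈ s, g • x.1 * x.2 = 0) := by
  classical
  have := Fintype.ofFinite Γ
  have hnorm : ∀ g : Γ, ∀ h ∈ Γ₀, g⁻¹ * h * g ∈ Γ₀ := by
    intro g h hh
    rw [hΓ₀] at hh ⊢
    intro x
    have := smul_mem_maximalIdeal g⁻¹ (hh (g • x))
    rwa [smul_sub, inv_smul_smul, smul_smul, smul_smul] at this
  have key : ∀ g ∉ Γ₀, ∃ t, (∀ h ∈ Γ₀, separatingFunctions (O := O) Γ₀ t h = 1) ∧
      separatingFunctions (O := O) Γ₀ t g = 0 := by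
    intro g hg
    rw [hΓ₀] at hg
    push Not at hg
    obtain ⟨x, hx⟩ := hg
    -- Summing over inertia makes x invariant and keeps it, modulo the maximal ideal, a unit
    -- multiple |Γ₀|x of x; hence x' - g(x') is still a unit.
    let x' : O := ∑ h : Γ₀, h.1 • x
    have hx'fix : ∀ h ∈ Γ₀, h • x' = x' := by
      intro h hh
      rw [Finset.smul_sum]
      refine Fintype.sum_equiv (Equiv.mulLeft (⟨h, hh⟩ : Γ₀)) _ _ fun k => ?_
      rw [smul_smul]
      rfl
    have hgx'fix : ∀ h ∈ Γ₀, h • g • x' = g • x' := by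
      intro h hh
      have := hx'fix _ (hnorm g h hh)
      rw [mul_smul, mul_smul, inv_smul_eq_iff] at this
      exact this
    have hx' : x' - Nat.card Γ₀ * x ∈ IsLocalRing.maximalIdeal O := by
      have : x' - Nat.card Γ₀ * x = ∑ h : Γ₀, (h.1 • x - x) := by
        rw [Finset.sum_sub_distrib, Finset.sum_const, Finset.card_univ, nsmul_eq_mul,
          Nat.card_eq_fintype_card]
      rw [this]
      exact Ideal.sum_mem _ fun h _ => (hΓ₀ _).1 h.2 x
    have hu : IsUnit (x' - g • x') := by
      by_contra hu
      have h1 : x' - g • x' ∈ IsLocalRing.maximalIdeal O := hu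
      have h2 := smul_mem_maximalIdeal g hx'
      have h3 : (Nat.card Γ₀ : O) * (g • x - x) ∈ IsLocalRing.maximalIdeal O := by
        have : (Nat.card Γ₀ : O) * (g • x - x) =
            (x' - Nat.card Γ₀ * x) - (x' - g • x') - g • (x' - Nat.card Γ₀ * x) := by
          have h4 : g • (Nat.card Γ₀ : O) = Nat.card Γ₀ :=
            map_natCast (MulSemiringAction.toRingHom Γ O g) _
          rw [smul_sub, smul_mul', h4]
          ring
        rw [this]
        exact Ideal.sub_mem _ (Ideal.sub_mem _ hx' h1) h2
      exact hx ((Ideal.unit_mul_mem_iff_mem _ hcard).1 h3)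
    obtain ⟨u, hu⟩ := hu
    have hufix : ∀ h ∈ Γ₀, h • ((u⁻¹ : Oˣ) : O) = (u⁻¹ : Oˣ) := by
      intro h hh
      refine smul_units_inv h u ?_
      rw [hu, smul_sub, hx'fix h hh, hgx'fix h hh]
    let μ : fixedSubring (O := O) Γ₀ := ⟨_, hufix⟩
    let ξ : fixedSubring (O := O) Γ₀ := ⟨_, hx'fix⟩
    -- This is the function h ↦ 1 - (x' - h(x'))/(x' - g(x')), equal to 1 on Γ₀ and to 0 at g. The
    -- product of these over all g outside Γ₀ is the indicator function of Γ₀.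
    refine ⟨1 - (TensorProduct.tmul ℤ (μ * ξ) 1 - TensorProduct.tmul ℤ μ x'), fun h hh => ?_, ?_⟩
    · rw [map_sub, map_sub, map_one, Pi.sub_apply, Pi.sub_apply, separatingFunctions_tmul,
        separatingFunctions_tmul, hx'fix h hh, smul_one]
      simp [ξ]
    · rw [map_sub, map_sub, map_one, Pi.sub_apply, Pi.sub_apply, separatingFunctions_tmul,
        separatingFunctions_tmul, smul_one, mul_one, Subring.coe_mul, ← mul_sub, ← hu]
      simp [μ]
  choose! t ht1 ht0 using key
  let T := ∏ g with g ∉ Γ₀, t g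
  have hT1 : ∀ h ∈ Γ₀, separatingFunctions (O := O) Γ₀ T h = 1 := by
    intro h hh
    rw [map_prod, Finset.prod_apply]
    exact Finset.prod_eq_one fun g hg => ht1 g (Finset.mem_filter.1 hg).2 h hh
  have hT0 : ∀ g ∉ Γ₀, separatingFunctions (O := O) Γ₀ T g = 0 := by
    intro g hg
    rw [map_prod, Finset.prod_apply]
    exact Finset.prod_eq_zero (Finset.mem_filter.2 ⟨Finset.mem_univ g, hg⟩) (ht0 g hg)
  obtain ⟨s, hs⟩ := TensorProduct.exists_finset T
  have hsT : ∀ g, separatingFunctions (O := O) Γ₀ T g = ∑ x ∈ s, x.1.1 * g • x.2 := by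
    intro g
    rw [hs, map_sum, Finset.sum_apply]
    exact Finset.sum_congr rfl fun x _ => separatingFunctions_tmul _ _ _ _
  obtain ⟨v, hv⟩ := hcard
  have hvfix : ∀ h : Γ, h • ((v⁻¹ : Oˣ) : O) = (v⁻¹ : Oˣ) := by
    intro h
    refine smul_units_inv h v ?_
    rw [hv]
    exact map_natCast (MulSemiringAction.toRingHom Γ O h) _
  -- The factor 1/|Γ₀| is absorbed into the invariant second entry of each pair.
  have hinj : Function.Injective
      (fun x : fixedSubring (O := O) Γ₀ × O => (x.2, ((v⁻¹ : Oˣ) : O) * x.1.1)) := by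
    rintro ⟨a, b⟩ ⟨c, d⟩ h
    simp only [Prod.mk.injEq, Units.mul_right_inj] at h
    exact Prod.ext (Subtype.ext h.2) h.1
  have hsum : ∀ g, ∑ x ∈ s.map ⟨_, hinj⟩, g • x.1 * x.2 =
      (v⁻¹ : Oˣ) * separatingFunctions (O := O) Γ₀ T g := by
    intro g
    rw [Finset.sum_map, hsT, Finset.mul_sum]
    exact Finset.sum_congr rfl fun x _ => by
      rw [Function.Embedding.coeFn_mk]
      ring
  refine ⟨s.map ⟨_, hinj⟩, fun x hx h hh => ?_, fun g hg => ?_, fun g hg => ?_⟩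
  · obtain ⟨y, -, rfl⟩ := Finset.mem_map.1 hx
    change h • (((v⁻¹ : Oˣ) : O) * y.1.1) = ((v⁻¹ : Oˣ) : O) * y.1.1
    rw [smul_mul', hvfix, y.1.2 h hh]
  · rw [hsum, hT1 g hg, mul_one, ← hv, Units.mul_inv]
  · rw [hsum, hT0 g hg, mul_zero]

/-- If the order of the inertia group is invertible, some element has trace `1`. -/
theorem exists_sum_smul_eq_one [IsLocalRing O] [Fintype Γ] (Γ₀ : Subgroup Γ)
    (hΓ₀ : ∀ g, g ∈ Γ₀ ↔ ∀ x : O, g • x - x ∈ IsLocalRing.maximalIdeal O)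
    (hcard : IsUnit (Nat.card Γ₀ : O)) : ∃ c : O, ∑ g : Γ, g • c = 1 := by
  classical
  obtain ⟨s, -, hs1, hs0⟩ := exists_galois_elements Γ₀ hΓ₀ hcard
  have h1 : ∑ x ∈ s, (∑ g : Γ, g • x.1) * x.2 = 1 := by
    simp_rw [Finset.sum_mul]
    rw [Finset.sum_comm, ← Finset.sum_filter_add_sum_filter_not Finset.univ (fun γ => γ ∈ Γ₀),
      Finset.sum_eq_zero (s := Finset.univ.filter (· ∉ Γ₀)) fun g hg =>
        hs0 g (Finset.mem_filter.1 hg).2, add_zero,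
      Finset.sum_congr rfl (g := fun _ => ∑ x ∈ s, (1 : Γ) • x.1 * x.2) fun g hg =>
        hcard.mul_left_cancel ((hs1 g (Finset.mem_filter.1 hg).2).trans (hs1 1 Γ₀.one_mem).symm),
      Finset.sum_const, nsmul_eq_mul, ← hs1 1 Γ₀.one_mem, Nat.card_eq_fintype_card,
      Fintype.card_subtype]
  -- By `h1`, 1 is a combination of traces; in a local ring one of them is a unit, and it is
  -- Γ-invariant, so dividing by it gives trace 1.
  have h2 : ∃ x ∈ s, IsUnit (∑ g : Γ, g • x.1) := by
    by_contra! h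
    have : (1 : O) ∈ IsLocalRing.maximalIdeal O := by
      rw [← h1]
      exact Ideal.sum_mem _ fun x hx => Ideal.mul_mem_right _ _ (h x hx)
    exact this isUnit_one
  obtain ⟨x, -, u, hu⟩ := h2
  have hfix : ∀ h : Γ, h • ((u⁻¹ : Oˣ) : O) = (u⁻¹ : Oˣ) := by
    intro h
    refine smul_units_inv h u ?_
    rw [hu, Finset.smul_sum]
    exact Fintype.sum_equiv (Equiv.mulLeft h) _ _ fun k => by rw [smul_smul]; rfl
  refine ⟨x.1 * (u⁻¹ : Oˣ), ?_⟩
  simp_rw [smul_mul', hfix, ← Finset.sum_mul]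
  rw [← hu, Units.mul_inv]

end Unramified

/-! ### Valuation rings of p-adic fields and tame inertia -/

section LocalField

variable (p : ℕ) [Fact p.Prime] (F : Type*) [Field F] [Algebra ℤ_[p] F] [Algebra ℚ_[p] F]
  [IsScalarTower ℤ_[p] ℚ_[p] F] [FiniteDimensional ℚ_[p] F]

theorem faithfulSMul_padicInt : FaithfulSMul ℤ_[p] F := by
  rw [faithfulSMul_iff_algebraMap_injective, IsScalarTower.algebraMap_eq ℤ_[p] ℚ_[p] F]
  exact (algebraMap ℚ_[p] F).injective.comp (IsFractionRing.injective ℤ_[p] ℚ_[p])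

theorem faithfulSMul_integers : FaithfulSMul ℤ_[p] (Integers p F) := by
  have := faithfulSMul_padicInt p F
  rw [faithfulSMul_iff_algebraMap_injective]
  exact Function.Injective.of_comp (f := Subtype.val)
    (FaithfulSMul.algebraMap_injective ℤ_[p] F)

theorem isFractionRing_integers : IsFractionRing (Integers p F) F :=
  integralClosure.isFractionRing_of_finite_extension ℚ_[p] F

theorem finite_integers : Module.Finite ℤ_[p] (Integers p F) :=
  IsIntegralClosure.finite ℤ_[p] ℚ_[p] F (Integers p F)

theorem isDedekindDomain_integers : IsDedekindDomain (Integers p F) :=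
  integralClosure.isDedekindDomain ℤ_[p] ℚ_[p] F

theorem isUnit_natCast_iff (n : ℕ) : IsUnit (n : Integers p F) ↔ ¬ p ∣ n := by
  have := faithfulSMul_integers p F
  have := finite_integers p F
  have h : IsUnit (n : ℤ_[p]) ↔ ¬ p ∣ n := by
    rw [PadicInt.isUnit_iff, ← not_iff_not, not_not, ← ne_eq]
    have := PadicInt.norm_int_lt_one_iff_dvd (p := p) (n : ℤ)
    rw [Int.natCast_dvd_natCast] at this
    rw [← this, Int.cast_natCast]
    exact ⟨fun h => lt_of_le_of_ne (PadicInt.norm_le_one _) h, fun h => h.ne⟩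
  rw [← h, ← map_natCast (algebraMap ℤ_[p] (Integers p F))]
  exact isUnit_map_iff (algebraMap ℤ_[p] (Integers p F)) _

theorem isDiscreteValuationRing_integers : IsDiscreteValuationRing (Integers p F) := by
  have := isDedekindDomain_integers p F
  refine { not_a_field' := fun h => ?_ }
  have h1 := (isUnit_natCast_iff p F p).not.2 (not_not.2 dvd_rfl)
  have h2 : (p : Integers p F) ∈ IsLocalRing.maximalIdeal (Integers p F) := h1
  have := faithfulSMul_integers p F
  rw [h, Ideal.mem_bot, ← map_natCast (algebraMap ℤ_[p] (Integers p F)),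
    map_eq_zero_iff _ (FaithfulSMul.algebraMap_injective _ _), Nat.cast_eq_zero] at h2
  exact (Fact.out : p.Prime).ne_zero h2

theorem perfectField_residueField :
    PerfectField (IsLocalRing.maximalIdeal (Integers p F)).ResidueField := by
  have := finite_integers p F
  have : Finite (ℤ_[p] ⧸ IsLocalRing.maximalIdeal ℤ_[p]) :=
    Finite.of_equiv (ZMod p) PadicInt.residueField.symm.toEquiv
  let m := IsLocalRing.maximalIdeal (Integers p F)
  have : m.LiesOver (IsLocalRing.maximalIdeal ℤ_[p]) :=
    ⟨(IsLocalRing.eq_maximalIdeal (Ideal.IsMaximal.under ℤ_[p] m)).symm⟩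
  have : Finite (Integers p F ⧸ m) :=
    Module.finite_of_finite (ℤ_[p] ⧸ IsLocalRing.maximalIdeal ℤ_[p])
  have : Finite m.ResidueField :=
    Finite.of_surjective _ (Ideal.bijective_algebraMap_quotient_residueField m).2
  infer_instance

variable (K L : Type*) [Field K] [Field L] [Algebra K L]
  [Algebra ℚ_[p] K] [FiniteDimensional ℚ_[p] K] [Algebra ℚ_[p] L] [FiniteDimensional ℚ_[p] L]
  [IsScalarTower ℚ_[p] K L] [IsGalois K L]
  [Algebra ℤ_[p] K] [IsScalarTower ℤ_[p] ℚ_[p] K]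
  [Algebra ℤ_[p] L] [IsScalarTower ℤ_[p] ℚ_[p] L] [IsScalarTower ℤ_[p] K L]

theorem coe_algebraMap_integers (x : Integers p K) :
    ((algebraMap (Integers p K) (Integers p L) x : Integers p L) : L) = algebraMap K L x :=
  rfl

theorem isGaloisGroup_integers : IsGaloisGroup Gal(L/K) (Integers p K) (Integers p L) where
  faithful := ⟨fun {g h} hgh => by
    have := isFractionRing_integers p L
    refine AlgEquiv.ext fun x => ?_
    obtain ⟨a, b, -, rfl⟩ := IsFractionRing.div_surjective (A := Integers p L) x
    have ha := congrArg Subtype.val (hgh a)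
    have hb := congrArg Subtype.val (hgh b)
    rw [integralClosure.coe_smul, integralClosure.coe_smul, AlgEquiv.smul_def,
      AlgEquiv.smul_def] at ha hb
    rw [map_div₀, map_div₀]
    exact congrArg₂ (· / ·) ha hb⟩
  commutes := ⟨fun g x y => Subtype.ext <| by
    rw [integralClosure.coe_smul, Algebra.smul_def, Algebra.smul_def, Subalgebra.coe_mul,
      Subalgebra.coe_mul, integralClosure.coe_smul, coe_algebraMap_integers, AlgEquiv.smul_def,
      AlgEquiv.smul_def, map_mul, AlgEquiv.commutes]⟩
  isInvariant := ⟨fun b hb => by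
    have h : ∀ g : Gal(L/K), g (b : L) = b := fun g => by
      have := congrArg Subtype.val (hb g)
      rwa [integralClosure.coe_smul] at this
    have : FiniteDimensional K L := FiniteDimensional.right ℚ_[p] K L
    obtain ⟨x, hx⟩ := (IsGalois.mem_bot_iff_fixed (F := K) (b : L)).2 h
    have hx' : algebraMap K L x = b := hx
    refine ⟨⟨x, ?_⟩, Subtype.ext hx⟩
    have hb' : IsIntegral ℤ_[p] (b : L) := b.2
    rw [← hx'] at hb'
    exact (isIntegral_algebraMap_iff (algebraMap K L).injective).1 hb'⟩

/-- The residue field is finite, hence perfect, so the order of inertia is the ramification index,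
which tameness makes prime to p. -/
theorem isUnit_card_inertiaGroup (htame : IsTame p K L) :
    IsUnit (Nat.card (inertiaGroup p K L) : Integers p L) := by
  rw [isUnit_natCast_iff]
  have : FiniteDimensional K L := FiniteDimensional.right ℚ_[p] K L
  have := isGaloisGroup_integers p K L
  have := finite_integers p L
  have := isDedekindDomain_integers p K
  have : IsScalarTower ℤ_[p] (Integers p K) (Integers p L) :=
    IsScalarTower.of_algebraMap_eq fun z => Subtype.ext <|
      IsScalarTower.algebraMap_apply ℤ_[p] K L z
  have : Module.Finite (Integers p K) (Integers p L) := Module.Finite.of_restrictScalars_finite ℤ_[p] _ _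
  have : FaithfulSMul (Integers p K) (Integers p L) := by
    rw [faithfulSMul_iff_algebraMap_injective]
    exact fun x y h => Subtype.ext ((algebraMap K L).injective (congrArg Subtype.val h))
  let m := IsLocalRing.maximalIdeal (Integers p K)
  let P := IsLocalRing.maximalIdeal (Integers p L)
  have : PerfectField m.ResidueField := perfectField_residueField p K
  have : P.LiesOver m :=
    ⟨(IsLocalRing.eq_maximalIdeal (Ideal.IsMaximal.under (Integers p K) P)).symm⟩
  have h : Nat.card (inertiaGroup p K L) = P.ramificationIdx (Integers p K) := by
    rw [← Ideal.ramificationIdxIn_eq_ramificationIdx m P Gal(L/K),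
      ← Ideal.card_inertia_eq_ramificationIdxIn m P (G := Gal(L/K))]
    rfl
  rw [h]
  exact htame

theorem mem_inertiaGroup_iff (g : Gal(L/K)) : g ∈ inertiaGroup p K L ↔
    ∀ x : Integers p L, g • x - x ∈ IsLocalRing.maximalIdeal (Integers p L) :=
  Iff.rfl

end LocalField

/-! ### Semilinear maps between group rings -/

section Twist

/-- The ring homomorphism `∑ c_η η ↦ ∑ f(c_η) s(η)` between group rings. -/
def twist {R R' Q Q' : Type*} [CommRing R] [CommRing R'] [CommGroup Q] [CommGroup Q']
    (f : R →+* R') (s : Q →* Q') : MonoidAlgebra R Q →+* MonoidAlgebra R' Q' :=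
  (MonoidAlgebra.mapDomainRingHom R' s).comp (MonoidAlgebra.mapRingHom Q f)

@[simp]
theorem twist_single {R R' Q Q' : Type*} [CommRing R] [CommRing R'] [CommGroup Q] [CommGroup Q']
    (f : R →+* R') (s : Q →* Q') (q : Q) (c : R) :
    twist f s (MonoidAlgebra.single q c) = MonoidAlgebra.single (s q) (f c) := by
  simp [twist]

/-- The inclusion of the range is ψ preceded by the inverse of the isomorphism from `A` onto the
range. -/
theorem flat_subtype_of_range_eq {A Λ : Type*} [CommRing A] [CommRing Λ] (ψ : A →+* Λ)
    (hψ : ψ.Flat) (hinj : Function.Injective ψ) (Λ₀ : Subring Λ) (h : ψ.range = Λ₀) :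
    Λ₀.subtype.Flat := by
  subst h
  let e : A ≃+* ψ.range := RingEquiv.ofBijective ψ.rangeRestrict
    ⟨fun x y hxy => hinj (congrArg Subtype.val hxy), ψ.rangeRestrict_surjective⟩
  have h1 : ψ.range.subtype = ψ.comp e.symm.toRingHom := by
    refine RingHom.ext fun x => ?_
    obtain ⟨a, rfl⟩ := e.surjective x
    simp only [RingHom.comp_apply, RingEquiv.toRingHom_eq_coe, RingHom.coe_coe,
      RingEquiv.symm_apply_apply]
    rfl
  rw [h1]
  exact RingHom.Flat.comp (RingHom.Flat.of_bijective e.symm.bijective) hψ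

end Twist

/-! ### Fixed rings for N = P × Q with trivial action on P -/

section Product

variable {O N P Q : Type*} [CommRing O] [CommGroup N] [CommGroup P] [CommGroup Q]

/-- The isomorphism `O[Q][P] ≃ O[N]` for `N = P × Q`. -/
def groupRingProdEquiv (e : P × Q ≃* N) :
    MonoidAlgebra (MonoidAlgebra O Q) P ≃+* MonoidAlgebra O N :=
  MonoidAlgebra.curryRingEquiv.symm.trans (MonoidAlgebra.mapDomainRingEquiv O e)

theorem groupRingProdEquiv_single (e : P × Q ≃* N) (x : P) (y : Q) (c : O) :
    groupRingProdEquiv e (MonoidAlgebra.single x (MonoidAlgebra.single y c)) =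
      MonoidAlgebra.single (e (x, y)) c := by
  simp [groupRingProdEquiv]

theorem twist_groupRingProdEquiv (e : P × Q ≃* N) (f : O →+* O) (s : N →* N) (t : Q →* Q)
    (hs : ∀ x y, s (e (x, y)) = e (x, t y)) (z : MonoidAlgebra (MonoidAlgebra O Q) P) :
    twist f s (groupRingProdEquiv e z) =
      groupRingProdEquiv e (MonoidAlgebra.mapRingHom P (twist f t) z) := by
  induction z using MonoidAlgebra.induction_linear with
  | zero => simp only [map_zero]
  | add x y hx hy => simp only [map_add, hx, hy]
  | single x w =>
    rw [MonoidAlgebra.mapRingHom_single]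
    induction w using MonoidAlgebra.induction_linear with
    | zero => simp only [MonoidAlgebra.single_zero, map_zero]
    | add a b ha hb => simp only [MonoidAlgebra.single_add, map_add, ha, hb]
    | single y c =>
      rw [twist_single, groupRingProdEquiv_single, groupRingProdEquiv_single, twist_single, hs]

/-- Let a family of automorphisms of `O` and of `N = P × Q` act trivially on `P`. If `O[Q]` is flat
over its fixed ring, then so is `O[N]`. -/
theorem flat_subtype_of_prod {R J : Type*} (e : P × Q ≃* N) [CommRing R]
    [Algebra R (MonoidAlgebra O Q)] [Module.Flat R (MonoidAlgebra O Q)] (f : J → (O →+* O))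
    (s : J → (N →* N)) (t : J → (Q →* Q)) (hs : ∀ j x y, s j (e (x, y)) = e (x, t j y))
    (hinj : Function.Injective (algebraMap R (MonoidAlgebra O Q)))
    (hR : ∀ w, w ∈ (algebraMap R (MonoidAlgebra O Q)).range ↔ ∀ j, twist (f j) (t j) w = w)
    (Λ₀ : Subring (MonoidAlgebra O N)) (hΛ₀ : ∀ z, z ∈ Λ₀ ↔ ∀ j, twist (f j) (s j) z = z) :
    Λ₀.subtype.Flat := by
  let ι := MonoidAlgebra.mapRingHom P (algebraMap R (MonoidAlgebra O Q))
  have hι : Function.Injective ι := mapRingHom_injective _ hinj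
  refine flat_subtype_of_range_eq ((groupRingProdEquiv e).toRingHom.comp ι)
    (RingHom.Flat.comp flat_mapRingHom (RingHom.Flat.of_bijective (groupRingProdEquiv e).bijective))
    ((groupRingProdEquiv e).injective.comp hι) _ (Subring.ext fun z => ?_)
  obtain ⟨z, rfl⟩ := (groupRingProdEquiv e).surjective z
  -- Under O[N] = O[Q][P] the automorphisms act coefficientwise, so the fixed ring is the group ring
  -- of P over the fixed ring of O[Q].
  have hz : groupRingProdEquiv e z ∈ Λ₀ ↔
      ∀ x, z.coeff x ∈ (algebraMap R (MonoidAlgebra O Q)).range := by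
    rw [hΛ₀]
    simp only [hR, twist_groupRingProdEquiv e _ _ _ (hs _), (groupRingProdEquiv e).injective.eq_iff]
    constructor
    · intro h x j
      have h2 := congrArg (fun z => z.coeff x) (h j)
      rwa [coeff_mapRingHom] at h2
    · intro h j
      refine coeff_ext fun x => ?_
      rw [coeff_mapRingHom]
      exact h x j
  rw [hz]
  constructor
  · rintro ⟨w, hw⟩ x
    have hw' : ι w = z := (groupRingProdEquiv e).injective hw
    rw [← hw', coeff_mapRingHom]
    exact ⟨_, rfl⟩
  · intro h
    choose c hc using h
    let w : MonoidAlgebra R P := ∑ x ∈ z.coeff.support, MonoidAlgebra.single x (c x)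
    refine ⟨w, congrArg (groupRingProdEquiv e) ?_⟩
    rw [map_sum]
    simp only [ι, MonoidAlgebra.mapRingHom_single, hc]
    exact MonoidAlgebra.sum_coeff_single z

end Product

/-! ### Flatness over the ring fixed by a subgroup -/

section FixedGroupRing

variable {p : ℕ} [Fact p.Prime] {K L : Type*} [Field K] [Field L] [Algebra K L]
  [Algebra ℚ_[p] K] [Algebra ℚ_[p] L] [FiniteDimensional ℚ_[p] L]
  [IsScalarTower ℚ_[p] K L]
  [Algebra ℤ_[p] K] [IsScalarTower ℤ_[p] ℚ_[p] K]
  [Algebra ℤ_[p] L] [IsScalarTower ℤ_[p] ℚ_[p] L] [IsScalarTower ℤ_[p] K L]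

theorem twist_algebraMap {Q R S : Type*} [CommGroup Q] [CommRing R] [CommRing S] [Algebra R S]
    (f : S →+* S) (hf : ∀ r, f (algebraMap R S r) = algebraMap R S r) (s : Q →* Q) (r : R) :
    twist f s (algebraMap R (MonoidAlgebra S Q) r) = algebraMap R (MonoidAlgebra S Q) r := by
  simp [hf]

variable (p) in
/-- The elements of `𝔒_L[Q]` fixed by a group acting on `L` and on `Q`. -/
def fixedGroupRing {Q : Type*} [CommGroup Q] (Γ₀ : Subgroup Gal(L/K))
    (s : Gal(L/K) → (Q →* Q)) : Subalgebra ℤ_[p] (MonoidAlgebra (Integers p L) Q) where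
  carrier := {w | ∀ g ∈ Γ₀, twist (MulSemiringAction.toRingHom Gal(L/K) (Integers p L) g) (s g) w = w}
  mul_mem' ha hb g hg := by rw [map_mul, ha g hg, hb g hg]
  add_mem' ha hb g hg := by rw [map_add, ha g hg, hb g hg]
  algebraMap_mem' z g _ := twist_algebraMap _ (fun r => by
    refine Subtype.ext ?_
    rw [MulSemiringAction.toRingHom_apply, integralClosure.coe_smul, AlgEquiv.smul_def]
    change g (algebraMap ℤ_[p] L r) = algebraMap ℤ_[p] L r
    rw [IsScalarTower.algebraMap_apply ℤ_[p] K L, AlgEquiv.commutes]) _ _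

/-- The fixed elements of 𝔒_L[Q] are those of 𝔒_L[Q] lying in the fixed ℚ_p-subalgebra of L[Q], so
`flat_of_mem_iff` applies to that subalgebra. -/
theorem flat_fixedGroupRing {Q : Type*} [CommGroup Q] [Finite Q] (hQ : ¬ p ∣ Nat.card Q)
    (Γ₀ : Subgroup Gal(L/K)) (s : Gal(L/K) → (Q →* Q)) :
    Module.Flat (fixedGroupRing p Γ₀ s) (MonoidAlgebra (Integers p L) Q) := by
  have := isDiscreteValuationRing_integers p L
  have := isFractionRing_integers p L
  have := finite_integers p L
  have := faithfulSMul_integers p L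
  let F : Subalgebra ℚ_[p] (MonoidAlgebra L Q) :=
    { carrier := {w | ∀ g ∈ Γ₀, twist (MulSemiringAction.toRingHom Gal(L/K) L g) (s g) w = w}
      mul_mem' := fun ha hb g hg => by rw [map_mul, ha g hg, hb g hg]
      add_mem' := fun ha hb g hg => by rw [map_add, ha g hg, hb g hg]
      algebraMap_mem' := fun z g _ => twist_algebraMap _ (fun r => by
        rw [MulSemiringAction.toRingHom_apply, AlgEquiv.smul_def,
          IsScalarTower.algebraMap_apply ℚ_[p] K L, AlgEquiv.commutes]) _ _ }
  refine flat_of_mem_iff (Z := ℤ_[p]) (k := ℚ_[p]) (O := Integers p L) (L := L)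
    ((isUnit_natCast_iff p L _).2 hQ) F _ fun w => ?_
  have hinj := mapRingHom_injective (Q := Q) (algebraMap (Integers p L) L)
    (IsFractionRing.injective _ _)
  have hcomm : ∀ g : Gal(L/K),
      twist (MulSemiringAction.toRingHom Gal(L/K) L g) (s g)
        (MonoidAlgebra.mapRingHom Q (algebraMap (Integers p L) L) w) =
      MonoidAlgebra.mapRingHom Q (algebraMap (Integers p L) L)
        (twist (MulSemiringAction.toRingHom Gal(L/K) (Integers p L) g) (s g) w) := by
    intro g
    induction w using MonoidAlgebra.induction_linear with
    | zero => simp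
    | add x y hx hy => simp only [map_add, hx, hy]
    | single q c =>
      rw [MonoidAlgebra.mapRingHom_single, twist_single, twist_single,
        MonoidAlgebra.mapRingHom_single]
      rfl
  constructor
  · intro h g hg
    rw [hcomm, h g hg]
  · intro h g hg
    exact hinj ((hcomm g).symm.trans (h g hg))

/-- If `Γ₀` acts trivially on `P` and the order of `Q` is prime to `p`, then `𝔒_L[P × Q]` is flat
over its subring of elements fixed by `Γ₀`. -/
theorem flat_fixedGroupRing_of_prod {N P Q : Type*} [CommGroup N] [CommGroup P] [CommGroup Q]
    [Finite Q] (e : P × Q ≃* N) (hQ : ¬ p ∣ Nat.card Q) (Γ₀ : Subgroup Gal(L/K))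
    (s : Gal(L/K) → (N →* N)) (t : Gal(L/K) → (Q →* Q))
    (hs : ∀ g ∈ Γ₀, ∀ x y, s g (e (x, y)) = e (x, t g y)) :
    (fixedGroupRing p Γ₀ s).toSubring.subtype.Flat := by
  have := flat_fixedGroupRing hQ Γ₀ t
  refine flat_subtype_of_prod e (R := fixedGroupRing p Γ₀ t)
    (fun g : Γ₀ => MulSemiringAction.toRingHom Gal(L/K) (Integers p L) g.1) (fun g => s g.1)
    (fun g => t g.1) (fun g x y => hs g.1 g.2 x y) Subtype.val_injective (fun w => ?_) _ fun z => ?_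
  · exact ⟨fun ⟨r, hr⟩ g => hr ▸ r.2 g.1 g.2, fun h => ⟨⟨w, fun g hg => h ⟨g, hg⟩⟩, rfl⟩⟩
  · exact ⟨fun h g => h g.1 g.2, fun h g hg => h ⟨g, hg⟩⟩

end FixedGroupRing

/-! ### Descent from inertia to the full group -/

section Galois

/-- A version of `projective_of_galois` with the conclusion that `Λ` is flat over the fixed ring
of `Γ` if it is flat over that of `Γ₀`. -/
theorem flat_of_galois {Z Λ Γ : Type*} [CommRing Z] [CommRing Λ] [Algebra Z Λ] [Group Γ] [Finite Γ]
    (A Λ₀ : Subalgebra Z Λ) (ρ : Γ →* (Λ →+* Λ)) (hA : ∀ z, z ∈ A ↔ ∀ γ, ρ γ z = z)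
    (Γ₀ : Subgroup Γ) (hΛ₀ : ∀ z, z ∈ Λ₀ ↔ ∀ γ ∈ Γ₀, ρ γ z = z) [Module.Flat Λ₀ Λ]
    {ι : Type*} [Fintype ι] (c μ : ι → Λ) (hμ : ∀ k, ∀ γ ∈ Γ₀, ρ γ (μ k) = μ k)
    (h1 : ∀ γ ∈ Γ₀, Nat.card Γ₀ * ∑ k, ρ γ (c k) * μ k = 1)
    (h0 : ∀ γ ∉ Γ₀, ∑ k, ρ γ (c k) * μ k = 0) : Module.Flat A Λ := by
  have hle : A ≤ Λ₀ := fun z hz => (hΛ₀ z).2 fun γ _ => (hA z).1 hz γ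
  let _ : Algebra A Λ₀ := (Subalgebra.inclusion hle).toRingHom.toAlgebra
  have : IsScalarTower A Λ₀ Λ := IsScalarTower.of_algebraMap_eq fun _ => rfl
  obtain ⟨-, hproj⟩ := projective_of_galois (A := A) (Λ₀ := Λ₀) ρ Subtype.val_injective
    (fun z => ⟨fun h => ⟨⟨z, (hA z).2 h⟩, rfl⟩, fun ⟨a, ha⟩ => ha ▸ (hA a.1).1 a.2⟩)
    Γ₀ Subtype.val_injective
    (fun z => ⟨fun h => ⟨⟨z, (hΛ₀ z).2 h⟩, rfl⟩, fun ⟨a, ha⟩ => ha ▸ (hΛ₀ a.1).1 a.2⟩)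
    c μ hμ h1 h0
  exact Module.Flat.trans A Λ₀ Λ

end Galois

/-! ### Flatness of the group ring over its Galois-fixed ring -/

section TameGroupRing

variable {p : ℕ} [Fact p.Prime] {K L : Type*} [Field K] [Field L] [Algebra K L]
  [Algebra ℚ_[p] K] [FiniteDimensional ℚ_[p] K] [Algebra ℚ_[p] L] [FiniteDimensional ℚ_[p] L]
  [IsScalarTower ℚ_[p] K L] [IsGalois K L]
  [Algebra ℤ_[p] K] [IsScalarTower ℤ_[p] ℚ_[p] K]
  [Algebra ℤ_[p] L] [IsScalarTower ℤ_[p] ℚ_[p] L] [IsScalarTower ℤ_[p] K L]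
  {N : Type*} [CommGroup N] [Finite N]

variable (p) in
theorem finite_groupRing : Module.Finite ℤ_[p] (MonoidAlgebra (Integers p L) N) := by
  have := finite_integers p L
  have : Module.Finite (Integers p L) (MonoidAlgebra (Integers p L) N) :=
    Module.Finite.equiv (MonoidAlgebra.coeffLinearEquiv (S := Integers p L) (M := N) (Integers p L)).symm
  exact Module.Finite.trans (Integers p L) _

theorem finite_fixedGroupRing (Γ₀ : Subgroup Gal(L/K)) (s : Gal(L/K) → (N →* N)) :
    Module.Finite ℤ_[p] (fixedGroupRing p Γ₀ s) := by
  have := finite_groupRing p (L := L) (N := N)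
  exact Module.Finite.of_injective (fixedGroupRing p Γ₀ s).val.toLinearMap Subtype.val_injective

theorem finite_over_fixedGroupRing (Γ₀ : Subgroup Gal(L/K)) (s : Gal(L/K) → (N →* N)) :
    Module.Finite (fixedGroupRing p Γ₀ s) (MonoidAlgebra (Integers p L) N) := by
  have := finite_groupRing p (L := L) (N := N)
  exact Module.Finite.of_restrictScalars_finite ℤ_[p] _ _

variable (p) in
/-- The semilinear action of the Galois group on `𝔒_L[N]` induced by an action on `N`. -/
def groupRingAction (σ : Gal(L/K) →* MulAut N) :
    Gal(L/K) →* (MonoidAlgebra (Integers p L) N →+* MonoidAlgebra (Integers p L) N) where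
  toFun g := twist (MulSemiringAction.toRingHom Gal(L/K) (Integers p L) g) (σ g).toMonoidHom
  map_one' := by
    refine RingHom.ext fun z => ?_
    induction z using MonoidAlgebra.induction_linear with
    | zero => simp only [map_zero]
    | add x y hx hy => rw [map_add, map_add, hx, hy]
    | single η c => simp
  map_mul' g h := by
    refine RingHom.ext fun z => ?_
    induction z using MonoidAlgebra.induction_linear with
    | zero => simp only [map_zero]
    | add x y hx hy => rw [map_add, map_add, hx, hy]
    | single η c => simp [mul_smul]

theorem groupRingAction_single (σ : Gal(L/K) →* MulAut N) (g : Gal(L/K)) (η : N)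
    (c : Integers p L) : groupRingAction p σ g (MonoidAlgebra.single η c) =
      MonoidAlgebra.single (σ g η) (g • c) :=
  twist_single _ _ _ _

/-- For an abelian group `N = P × Q` with `Q` of order prime to `p` on which a tame Galois group
acts, with inertia acting trivially on `P`, the group ring `𝔒_L[N]` is flat over its fixed ring. -/
theorem flat_over_fixedGroupRing (htame : IsTame p K L) {P Q : Type*} [CommGroup P] [CommGroup Q]
    [Finite Q] (e : P × Q ≃* N) (hQ : ¬ p ∣ Nat.card Q) (σ : Gal(L/K) →* MulAut N)
    (t : Gal(L/K) → (Q →* Q))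
    (hs : ∀ g ∈ inertiaGroup p K L, ∀ x y, σ g (e (x, y)) = e (x, t g y)) :
    Module.Flat (fixedGroupRing p ⊤ fun g : Gal(L/K) => (σ g).toMonoidHom)
      (MonoidAlgebra (Integers p L) N) := by
  have : FiniteDimensional K L := FiniteDimensional.right ℚ_[p] K L
  let s : Gal(L/K) → (N →* N) := fun g => (σ g).toMonoidHom
  let A := fixedGroupRing p (⊤ : Subgroup Gal(L/K)) s
  let Λ₀ := fixedGroupRing p (inertiaGroup p K L) s
  let ρ := groupRingAction p σ
  have h₀ : Module.Flat Λ₀ (MonoidAlgebra (Integers p L) N) :=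
    flat_fixedGroupRing_of_prod e hQ (inertiaGroup p K L) s t hs
  obtain ⟨u, hu, hu1, hu0⟩ := exists_galois_elements (inertiaGroup p K L)
    (mem_inertiaGroup_iff p K L) (isUnit_card_inertiaGroup p K L htame)
  -- The Galois elements of 𝔒_L are placed at the identity of `N`, which every σ g fixes, so their
  -- relations carry over to the group ring.
  let ε : Integers p L →+* MonoidAlgebra (Integers p L) N := MonoidAlgebra.singleOneRingHom
  have hε : ∀ g c, ρ g (ε c) = ε (g • c) := by
    intro g c
    exact (groupRingAction_single _ _ _ _).trans (by rw [map_one]; rfl)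
  have hεsum : ∀ g, ∑ x : u, ρ g (ε x.1.1) * ε x.1.2 = ε (∑ x ∈ u, g • x.1 * x.2) := by
    intro g
    rw [map_sum, ← Finset.sum_coe_sort u fun x => ε (g • x.1 * x.2)]
    simp only [hε, map_mul]
  exact flat_of_galois A Λ₀ ρ (fun z => ⟨fun h g => h g trivial, fun h g _ => h g⟩)
    (inertiaGroup p K L) (fun z => Iff.rfl)
    (fun x : u => ε x.1.1) (fun x : u => ε x.1.2)
    (fun x g hg => by rw [hε, hu x.1 x.2 g hg])
    (fun g hg => by rw [hεsum, ← map_natCast ε, ← map_mul, hu1 g hg, map_one])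
    (fun g hg => by rw [hεsum, hu0 g hg, map_zero])

end TameGroupRing

/-! ### Primary decomposition of a finite abelian group -/

section PrimaryDecomposition

/-- The decomposition of a finite abelian group into its `p`-part and its prime-to-`p`-part. -/
theorem exists_primary_decomposition (p : ℕ) [Fact p.Prime] (N : Type*) [CommGroup N] [Finite N] :
    ∃ (P Q : Subgroup N) (e : P × Q ≃* N), (∀ x y, e (x, y) = x.1 * y.1) ∧ ¬ p ∣ Nat.card Q ∧
      (∀ x ∈ P, ∃ k : ℕ, x ^ p ^ k = 1) ∧
      ∀ (f : N →* N), ∀ y ∈ Q, f y ∈ Q := by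
  have hp : p.Prime := Fact.out
  obtain ⟨k, m, hpm, hn⟩ := Nat.exists_eq_pow_mul_and_not_dvd
    (Nat.card_pos (α := N)).ne' p hp.ne_one
  let P : Subgroup N := (powMonoidHom (p ^ k)).ker
  let Q : Subgroup N := (powMonoidHom m).ker
  have hP : ∀ x, x ∈ P ↔ x ^ p ^ k = 1 := fun x => Iff.rfl
  have hQ : ∀ x, x ∈ Q ↔ x ^ m = 1 := fun x => Iff.rfl
  have hcop : IsCoprime ((p ^ k : ℕ) : ℤ) (m : ℤ) :=
    Nat.isCoprime_iff_coprime.2 (((Nat.Prime.coprime_iff_not_dvd hp).2 hpm).pow_left k)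
  obtain ⟨a, b, hab⟩ := hcop
  let φ : P × Q →* N := P.subtype.coprod Q.subtype
  have hφ : Function.Bijective φ := by
    constructor
    · refine (injective_iff_map_eq_one φ).2 fun ⟨x, y⟩ h => ?_
      have hxy : x.1 * y.1 = 1 := h
      have hx : x.1 = 1 := by
        have h1 : x.1 ^ p ^ k = 1 := x.2
        have h2 : x.1 ^ m = 1 := by
          have h3 : y.1 ^ m = 1 := y.2
          have := congrArg (· ^ m) hxy
          simpa [mul_pow, h3] using this
        rw [← zpow_one x.1, ← hab, zpow_add, mul_comm a, mul_comm b, zpow_mul, zpow_mul,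
          zpow_natCast, zpow_natCast, h1, h2, one_zpow, one_zpow, one_mul]
      have hy : y.1 = 1 := by rwa [hx, one_mul] at hxy
      exact Prod.ext (Subtype.ext hx) (Subtype.ext hy)
    · intro x
      have hx : x ^ Nat.card N = 1 := pow_card_eq_one'
      refine ⟨(⟨x ^ (b * m), ?_⟩, ⟨x ^ (a * (p ^ k : ℕ)), ?_⟩), ?_⟩
      · rw [hP, ← zpow_natCast, ← zpow_mul, mul_assoc, ← Nat.cast_mul, mul_comm m, ← hn, mul_comm b,
          zpow_mul, zpow_natCast, hx, one_zpow]
      · rw [hQ, ← zpow_natCast, ← zpow_mul, mul_assoc, ← Nat.cast_mul, ← hn, mul_comm a,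
          zpow_mul, zpow_natCast, hx, one_zpow]
      · change x ^ (b * m) * x ^ (a * (p ^ k : ℕ)) = x
        rw [← zpow_add, add_comm, hab, zpow_one]
  refine ⟨P, Q, MulEquiv.ofBijective φ hφ, fun x y => rfl, fun hdvd => ?_, fun x hx => ⟨k, hx⟩,
    fun f y hy => ?_⟩
  · obtain ⟨y, hy⟩ := exists_prime_orderOf_dvd_card' p hdvd
    have h1 : y ^ m = 1 := Subtype.ext y.2
    have := orderOf_dvd_of_pow_eq_one h1
    rw [hy] at this
    exact hpm this
  · rw [hQ] at hy ⊢
    rw [← map_pow, hy, map_one]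

end PrimaryDecomposition

/-! ### Independence of automorphisms -/

section Independence

variable {p : ℕ} [Fact p.Prime] {K L : Type*} [Field K] [Field L] [Algebra K L]
  [Algebra ℚ_[p] K] [FiniteDimensional ℚ_[p] K] [Algebra ℚ_[p] L] [FiniteDimensional ℚ_[p] L]
  [IsScalarTower ℚ_[p] K L] [IsGalois K L]
  [Algebra ℤ_[p] K] [IsScalarTower ℤ_[p] ℚ_[p] K]
  [Algebra ℤ_[p] L] [IsScalarTower ℤ_[p] ℚ_[p] L] [IsScalarTower ℤ_[p] K L]

variable (p K L) in
/-- There is a family of integers `ω i` of `L` for which the matrix `g (ω i)` is invertible. -/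
theorem exists_isUnit_matrix [Fintype Gal(L/K)] [DecidableEq Gal(L/K)] :
    ∃ ω : Gal(L/K) → Integers p L,
      IsUnit (Matrix.of fun (g : Gal(L/K)) i => g (ω i : L)) := by
  have : FiniteDimensional K L := FiniteDimensional.right ℚ_[p] K L
  have := isFractionRing_integers p K
  have : IsScalarTower ℤ_[p] (Integers p K) L := IsScalarTower.of_algebraMap_eq fun z =>
    IsScalarTower.algebraMap_apply ℤ_[p] K L z
  obtain ⟨s, b, hb⟩ := FiniteDimensional.exists_is_basis_integral (Integers p K) K L
  have hcard : Fintype.card s = Fintype.card Gal(L/K) := by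
    rw [← Module.finrank_eq_card_basis b, ← IsGalois.card_aut_eq_finrank, Nat.card_eq_fintype_card]
  let e := Fintype.equivOfCardEq hcard
  let b' := b.reindex e
  have hb' : ∀ i, b' i ∈ Integers p L := fun i => by
    rw [Module.Basis.reindex_apply]
    have : Algebra.IsIntegral ℤ_[p] (Integers p K) := integralClosure.AlgebraIsIntegral
    exact isIntegral_trans _ (hb _)
  refine ⟨fun i => ⟨b' i, hb' i⟩, ?_⟩
  rw [← Matrix.vecMul_injective_iff_isUnit]
  refine (injective_iff_map_eq_zero (Matrix.vecMulLinear _)).2 fun y hy => ?_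
  -- A vector in the left kernel is a linear relation between the automorphisms on a K-basis of `L`,
  -- hence everywhere, contradicting Dedekind's independence unless it is zero.
  have hli : LinearIndependent L fun g : Gal(L/K) => (g : L →ₐ[K] L).toLinearMap :=
    (linearIndependent_toLinearMap K L L).comp _ AlgEquiv.coe_toAlgHom_injective
  rw [Fintype.linearIndependent_iff] at hli
  refine funext (hli y (b'.ext fun i => ?_))
  have := congrFun hy i
  rw [Matrix.vecMulLinear_apply, Matrix.vecMul, dotProduct] at this
  simpa using this

end Independence

/-! ### Coefficients of products and twists -/

section Coefficients

variable {O N : Type*} [CommRing O] [CommGroup N]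

theorem coeff_mul_eq_sum [Fintype N] (x y : MonoidAlgebra O N) (η : N) :
    (x * y).coeff η = ∑ μ, x.coeff μ * y.coeff (μ⁻¹ * η) := by
  classical
  induction x using MonoidAlgebra.induction_linear with
  | zero => simp
  | add a b ha hb =>
    rw [add_mul, MonoidAlgebra.coeff_add, Finsupp.add_apply, ha, hb, ← Finset.sum_add_distrib]
    exact Finset.sum_congr rfl fun μ _ => by
      rw [MonoidAlgebra.coeff_add, Finsupp.add_apply, add_mul]
  | single μ c =>
    rw [Finset.sum_eq_single μ]
    · simp
    · intro ν _ hν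
      rw [MonoidAlgebra.coeff_single, Finsupp.single_eq_of_ne hν, zero_mul]
    · simp

theorem coeff_twist (f : O →+* O) (s : MulAut N) (z : MonoidAlgebra O N) (η : N) :
    (twist f s.toMonoidHom z).coeff (s η) = f (z.coeff η) := by
  classical
  induction z using MonoidAlgebra.induction_linear with
  | zero => simp
  | add a b ha hb =>
    rw [map_add, MonoidAlgebra.coeff_add, Finsupp.add_apply, ha, hb, MonoidAlgebra.coeff_add,
      Finsupp.add_apply, map_add]
  | single μ c =>
    rw [twist_single, MonoidAlgebra.coeff_single, MonoidAlgebra.coeff_single,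
      Finsupp.single_apply, Finsupp.single_apply]
    have : s.toMonoidHom μ = s η ↔ μ = η := s.injective.eq_iff
    by_cases h : μ = η
    · rw [if_pos h, if_pos (this.2 h)]
    · rw [if_neg h, if_neg (this.not.2 h), map_zero]

theorem coeff_singleOne_mul (c : O) (z : MonoidAlgebra O N) (η : N) :
    (MonoidAlgebra.single 1 c * z).coeff η = c * z.coeff η := by
  simp

theorem coeff_sum {ι : Type*} (s : Finset ι) (f : ι → MonoidAlgebra O N) (η : N) :
    (∑ i ∈ s, f i).coeff η = ∑ i ∈ s, (f i).coeff η := by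
  simp

end Coefficients

/-! ### Fractional ideals as retracts of the group ring -/

section Ideals

variable {p : ℕ} [Fact p.Prime] {K L : Type*} [Field K] [Field L] [Algebra K L]
  [Algebra ℚ_[p] K] [FiniteDimensional ℚ_[p] K] [Algebra ℚ_[p] L] [FiniteDimensional ℚ_[p] L]
  [IsScalarTower ℚ_[p] K L] [IsGalois K L]
  [Algebra ℤ_[p] K] [IsScalarTower ℤ_[p] ℚ_[p] K]
  [Algebra ℤ_[p] L] [IsScalarTower ℤ_[p] ℚ_[p] L] [IsScalarTower ℤ_[p] K L]
  {N : Type*} [CommGroup N] [Fintype N]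

theorem gal_coeff (σ : Gal(L/K) →* MulAut N) {a : MonoidAlgebra (Integers p L) N} {g : Gal(L/K)}
    (ha : twist (MulSemiringAction.toRingHom Gal(L/K) (Integers p L) g) (σ g).toMonoidHom a = a)
    (η : N) : g (a.coeff η : L) = a.coeff (σ g η) := by
  have h := congrArg (fun z => ((z.coeff (σ g η) : Integers p L) : L)) ha
  exact (congrArg Subtype.val (coeff_twist _ (σ g) a η)).symm.trans h

variable (σ : Gal(L/K) →* MulAut N) (κ : N ≃ Gal(L/K))
  (hκ : ∀ η μ, κ (σ (κ η) μ * η) = κ η * κ μ) {A : Type*} [CommRing A]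
  [Algebra A (MonoidAlgebra (Integers p L) N)]
  (hA : ∀ (a : A) g, twist (MulSemiringAction.toRingHom Gal(L/K) (Integers p L) g)
    (σ g).toMonoidHom (algebraMap A _ a) = algebraMap A (MonoidAlgebra (Integers p L) N) a)
  {I : Submodule (Integers p L) L} [Module A I]
  (hact : ∀ (a : A) (x : I), ((a • x : I) : L) =
    ∑ μ, ((algebraMap A (MonoidAlgebra (Integers p L) N) a).coeff μ : L) * κ μ⁻¹ x)
  (b : L) (hb : b ≠ 0) (hI : ∀ x, x ∈ I ↔ ∃ c : Integers p L, c * b = x)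

include hκ hA hact hb hI in
/-- The embedding `x ↦ ∑ b⁻¹ κ(η)(x) η` of the fractional ideal generated by `b` into the group
ring. -/
theorem exists_embedding : ∃ j : I →ₗ[A] MonoidAlgebra (Integers p L) N,
    ∀ x η, ((j x).coeff η : L) = b⁻¹ * κ η x := by
  have hmem : ∀ (x : I) (η : N), b⁻¹ * κ η x ∈ Integers p L := by
    intro x η
    have h := gal_mem I (κ η) x.2
    rw [hI] at h
    obtain ⟨c, hc⟩ := h
    rw [← hc, mul_comm (c : L), inv_mul_cancel_left₀ hb]
    exact c.2
  let j : I → MonoidAlgebra (Integers p L) N := fun x =>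
    MonoidAlgebra.ofCoeff (Finsupp.equivFunOnFinite.symm fun η => ⟨b⁻¹ * κ η x, hmem x η⟩)
  have hj : ∀ x η, ((j x).coeff η : L) = b⁻¹ * κ η x := fun x η => rfl
  refine ⟨⟨⟨j, fun x y => ?_⟩, fun a x => ?_⟩, hj⟩
  · refine coeff_ext fun η => Subtype.ext ?_
    rw [MonoidAlgebra.coeff_add, Finsupp.add_apply, Subalgebra.coe_add, hj, hj, hj,
      Submodule.coe_add, map_add, mul_add]
  · refine coeff_ext fun η => Subtype.ext ?_
    rw [RingHom.id_apply, Algebra.smul_def, coeff_mul_eq_sum, hj, hact, map_sum,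
      Finset.mul_sum, AddSubmonoidClass.coe_finsetSum]
    -- Invariance of a gives κ(η)(a_μ) = a_ν with ν = σ(κ(η))(μ), and `hκ` gives κ(η)κ(μ⁻¹) =
    -- κ(ν⁻¹η); so the substitution μ ↦ ν produces the convolution a · j(x).
    refine Fintype.sum_equiv (σ (κ η)).toEquiv _ _ fun μ => ?_
    have h1 : κ η (κ μ⁻¹ x) = κ ((σ (κ η) μ)⁻¹ * η) x := by
      rw [← map_inv, hκ, AlgEquiv.mul_apply]
    rw [map_mul, gal_coeff σ (hA a _), h1, Subalgebra.coe_mul, hj]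
    change _ = ((algebraMap A (MonoidAlgebra (Integers p L) N) a).coeff (σ (κ η) μ) : L) *
      (b⁻¹ * κ ((σ (κ η) μ)⁻¹ * η) x)
    ring

include hκ hA hact hI in
/-- The projection `z ↦ ∑ κ(η)⁻¹(b z_η)` of the group ring to the fractional ideal generated by
`b`. -/
theorem exists_projection : ∃ τ : MonoidAlgebra (Integers p L) N →ₗ[A] I,
    ∀ z, (τ z : L) = ∑ η, (κ η)⁻¹ (b * z.coeff η) := by
  have hmem : ∀ z : MonoidAlgebra (Integers p L) N, ∑ η, (κ η)⁻¹ (b * z.coeff η) ∈ I := by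
    intro z
    refine I.sum_mem fun η _ => gal_mem I _ ?_
    rw [hI]
    exact ⟨z.coeff η, mul_comm _ _⟩
  refine ⟨⟨⟨fun z => ⟨_, hmem z⟩, fun x y => Subtype.ext ?_⟩, fun a z => Subtype.ext ?_⟩,
    fun z => rfl⟩
  · simp only [MonoidAlgebra.coeff_add, Finsupp.add_apply, Subalgebra.coe_add, mul_add, map_add,
      Finset.sum_add_distrib, Submodule.coe_add]
  · rw [RingHom.id_apply, hact]
    simp only [Algebra.smul_def]
    set α := algebraMap A (MonoidAlgebra (Integers p L) N) a with hα
    change ∑ η, (κ η)⁻¹ (b * ((α * z).coeff η : L)) =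
      ∑ μ, (α.coeff μ : L) * κ μ⁻¹ (∑ η, (κ η)⁻¹ (b * z.coeff η))
    have h1 : ∀ η, (κ η)⁻¹ (b * ((α * z).coeff η : L)) =
        ∑ μ, (α.coeff μ : L) * (κ η)⁻¹ (b * z.coeff (κ.symm (κ η * κ μ⁻¹))) := by
      intro η
      rw [coeff_mul_eq_sum, AddSubmonoidClass.coe_finsetSum, Finset.mul_sum, map_sum]
      refine (Fintype.sum_equiv (σ (κ η)).toEquiv _ _ fun μ => ?_).symm
      change _ = (κ η)⁻¹ (b * ((α.coeff (σ (κ η) μ) * z.coeff ((σ (κ η) μ)⁻¹ * η) :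
        Integers p L) : L))
      have h2 : κ.symm (κ η * κ μ⁻¹) = (σ (κ η) μ)⁻¹ * η := by
        rw [← hκ, Equiv.symm_apply_apply, map_inv]
      have h3 : (κ η)⁻¹ (α.coeff (σ (κ η) μ) : L) = α.coeff μ := by
        rw [← gal_coeff σ (hA a _), ← AlgEquiv.mul_apply, inv_mul_cancel, AlgEquiv.one_apply]
      rw [h2, Subalgebra.coe_mul, mul_left_comm, map_mul _ (α.coeff _ : L), h3]
    simp_rw [h1]
    rw [Finset.sum_comm]
    refine Finset.sum_congr rfl fun μ _ => ?_
    rw [map_sum, Finset.mul_sum]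
    -- The substitution replaces κ(η) by κ(η)κ(μ⁻¹), whose inverse is cancelled on the left by
    -- κ(μ⁻¹).
    refine Fintype.sum_equiv (κ.trans ((Equiv.mulRight (κ μ⁻¹)).trans κ.symm)) _ _ fun η => ?_
    change _ = (α.coeff μ : L) * κ μ⁻¹ ((κ (κ.symm (κ η * κ μ⁻¹)))⁻¹
      (b * z.coeff (κ.symm (κ η * κ μ⁻¹))))
    rw [Equiv.apply_symm_apply, ← AlgEquiv.mul_apply, mul_inv_rev, mul_inv_cancel_left]

-- As a retract of the group ring, `I` is finite and flat; the family ω then yields injections both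
-- ways between A^n and I^n, which force rank 1.
include hκ hA hact hb hI in
theorem free_of_principal (htame : IsTame p K L) (hinj : Function.Injective (algebraMap A
      (MonoidAlgebra (Integers p L) N)))
    (hA' : ∀ z : MonoidAlgebra (Integers p L) N, (∀ g, twist (MulSemiringAction.toRingHom Gal(L/K)
      (Integers p L) g) (σ g).toMonoidHom z = z) → z ∈ (algebraMap A _).range)
    [Module.Flat A (MonoidAlgebra (Integers p L) N)]
    [Module.Finite A (MonoidAlgebra (Integers p L) N)] [Finite (MaximalSpectrum A)] :
    Module.Free A I := by
  classical
  have : FiniteDimensional K L := FiniteDimensional.right ℚ_[p] K L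
  obtain ⟨j, hj⟩ := exists_embedding σ κ hκ hA hact b hb hI
  obtain ⟨τ, hτ⟩ := exists_projection σ κ hκ hA hact b hI
  let m : Integers p L → MonoidAlgebra (Integers p L) N →ₗ[A] MonoidAlgebra (Integers p L) N :=
    fun c => LinearMap.mulLeft A (MonoidAlgebra.single 1 c)
  have hm : ∀ c z η, ((m c z).coeff η : L) = c * z.coeff η := fun c z η =>
    congrArg Subtype.val (coeff_singleOne_mul c z η)
  obtain ⟨c, hc⟩ := exists_sum_smul_eq_one (inertiaGroup p K L)
    (mem_inertiaGroup_iff p K L) (isUnit_card_inertiaGroup p K L htame)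
  -- The factors b and b⁻¹ cancel, leaving ∑ κ(η)⁻¹(c) x, which is x times the trace of c.
  have hret : (τ ∘ₗ m c) ∘ₗ j = LinearMap.id := by
    refine LinearMap.ext fun x => Subtype.ext ?_
    rw [LinearMap.comp_apply, LinearMap.comp_apply, hτ, LinearMap.id_apply]
    have h1 : ∀ η, (κ η)⁻¹ (b * ((m c (j x)).coeff η : L)) = (κ η)⁻¹ (c : L) * x := by
      intro η
      rw [hm, hj, mul_left_comm, mul_inv_cancel_left₀ hb, map_mul, ← AlgEquiv.mul_apply,
        inv_mul_cancel, AlgEquiv.one_apply]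
    simp_rw [h1]
    rw [← Finset.sum_mul]
    have h2 : ∑ η, (κ η)⁻¹ (c : L) = 1 := by
      rw [Fintype.sum_equiv (κ.trans (Equiv.inv _)) (fun η => (κ η)⁻¹ (c : L))
        (fun g : Gal(L/K) => g (c : L)) fun η => rfl]
      have := congrArg Subtype.val hc
      rwa [AddSubmonoidClass.coe_finsetSum] at this
    rw [h2, one_mul]
  have : Module.Flat A I := Module.Flat.of_retract j (τ ∘ₗ m c) hret
  have : Module.Finite A I :=
    Module.Finite.of_surjective (τ ∘ₗ m c) fun x => ⟨j x, LinearMap.congr_fun hret x⟩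
  obtain ⟨ω, hω⟩ := exists_isUnit_matrix p K L
  have hα : ∀ x : Gal(L/K) → L, (∀ g : Gal(L/K), ∑ i, g (ω i : L) * x i = 0) → x = 0 :=
    fun x hx => (Matrix.mulVec_injective_iff_isUnit.2 hω) ((funext hx).trans (Matrix.mulVec_zero _).symm)
  have hβ : ∀ y : Gal(L/K) → L, (∀ i, ∑ g : Gal(L/K), y g * g (ω i : L) = 0) → y = 0 :=
    fun y hy => (Matrix.vecMul_injective_iff_isUnit.2 hω) ((funext hy).trans (Matrix.zero_vecMul _).symm)
  obtain ⟨tr, htr⟩ := exists_trace (groupRingAction p σ) hinj fun z =>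
    ⟨hA' z, fun ⟨a, ha⟩ g => ha ▸ hA a g⟩
  -- Both comparisons pass through Λ: A^n and I^n map into it by ∑ ω i a_i and ∑ ω i j(x_i), and it
  -- maps to I^n and A^n by τ(ω i z) and tr(ω i z). Each map is injective because the matrix (g(ω
  -- i)) is invertible.
  let combA : (Gal(L/K) → A) →ₗ[A] MonoidAlgebra (Integers p L) N :=
    ∑ i, m (ω i) ∘ₗ Algebra.linearMap A _ ∘ₗ LinearMap.proj i
  let combI : (Gal(L/K) → I) →ₗ[A] MonoidAlgebra (Integers p L) N :=
    ∑ i, m (ω i) ∘ₗ j ∘ₗ LinearMap.proj i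
  have hcombA : ∀ x η, ((combA x).coeff η : L) =
      ∑ i, (ω i : L) * (algebraMap A (MonoidAlgebra (Integers p L) N) (x i)).coeff η := by
    intro x η
    simp only [combA, LinearMap.sum_apply, coeff_sum, AddSubmonoidClass.coe_finsetSum]
    exact Finset.sum_congr rfl fun i _ => hm _ _ _
  have hcombI : ∀ x η, ((combI x).coeff η : L) = ∑ i, (ω i : L) * (b⁻¹ * κ η (x i)) := by
    intro x η
    simp only [combI, LinearMap.sum_apply, coeff_sum, AddSubmonoidClass.coe_finsetSum]
    exact Finset.sum_congr rfl fun i _ => (hm _ _ _).trans (by rw [← hj]; rfl)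
  have hcombA_inj : Function.Injective combA := by
    refine (injective_iff_map_eq_zero combA).2 fun x hx => funext fun i => hinj ?_
    rw [Pi.zero_apply, map_zero]
    refine coeff_ext fun η => Subtype.ext ?_
    refine congrFun (hα (fun i => (algebraMap A (MonoidAlgebra (Integers p L) N) (x i)).coeff η)
      fun g => ?_) i
    have h := hcombA x ((σ g).symm η)
    rw [hx] at h
    -- For elements of `A`, applying g to the coefficient at σ(g)⁻¹η gives the coefficient at η, so
    -- every g yields an equation in the same unknowns.
    have h2 := congrArg g h
    rw [map_sum] at h2
    refine Eq.trans ?_ (h2.symm.trans (map_zero g))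
    refine Finset.sum_congr rfl fun i _ => ?_
    rw [map_mul, gal_coeff σ (hA (x i) g), MulEquiv.apply_symm_apply]
  have hcombI_inj : Function.Injective combI := by
    refine (injective_iff_map_eq_zero combI).2 fun x hx => funext fun i => Subtype.ext ?_
    refine congrFun (hα (fun i => (x i : L)) fun g => ?_) i
    have h := hcombI x (κ.symm g⁻¹)
    rw [hx, Equiv.apply_symm_apply] at h
    have h1 : b⁻¹ * ∑ i, (ω i : L) * g⁻¹ (x i : L) = 0 := by
      rw [Finset.mul_sum]
      refine Eq.trans (Finset.sum_congr rfl fun i _ => ?_) h.symm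
      ring
    have h2 := congrArg g ((mul_eq_zero.1 h1).resolve_left (inv_ne_zero hb))
    rw [map_sum, map_zero] at h2
    refine Eq.trans (Finset.sum_congr rfl fun i _ => ?_) h2
    rw [map_mul, ← AlgEquiv.mul_apply g, mul_inv_cancel, AlgEquiv.one_apply]
  let projI : MonoidAlgebra (Integers p L) N →ₗ[A] (Gal(L/K) → I) :=
    LinearMap.pi fun i => τ ∘ₗ m (ω i)
  let projA : MonoidAlgebra (Integers p L) N →ₗ[A] (Gal(L/K) → A) :=
    LinearMap.pi fun i => tr ∘ₗ m (ω i)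
  have hprojI : Function.Injective projI := by
    refine (injective_iff_map_eq_zero projI).2 fun z hz => coeff_ext fun η => Subtype.ext ?_
    have h := hβ (fun g => g (b * z.coeff (κ.symm g⁻¹))) fun i => by
      have h1 := congrArg Subtype.val (congrFun hz i)
      refine Eq.trans ?_ ((hτ (m (ω i) z)).symm.trans h1)
      refine (Fintype.sum_equiv (κ.trans (Equiv.inv _)) _ _ fun η => ?_).symm
      change (κ η)⁻¹ (b * ((m (ω i) z).coeff η : L)) =
        (κ η)⁻¹ (b * z.coeff (κ.symm (κ η)⁻¹⁻¹)) * (κ η)⁻¹ (ω i : L)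
      rw [inv_inv, Equiv.symm_apply_apply, hm, ← map_mul]
      congr 1
      ring
    have h1 := congrFun h (κ η)⁻¹
    rw [Pi.zero_apply, inv_inv, Equiv.symm_apply_apply, map_eq_zero_iff _ (AlgEquiv.injective _)]
      at h1
    exact (mul_eq_zero.1 h1).resolve_left hb
  have hprojA : Function.Injective projA := by
    refine (injective_iff_map_eq_zero projA).2 fun z hz => coeff_ext fun η => Subtype.ext ?_
    have h := hβ (fun g => ((groupRingAction p σ g z).coeff η : L)) fun i => by
      have h1 := congrArg (algebraMap A (MonoidAlgebra (Integers p L) N)) (congrFun hz i)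
      have h2 := congrArg (fun w => ((w.coeff η : Integers p L) : L)) ((htr (m (ω i) z)).symm.trans h1)
      rw [Pi.zero_apply, map_zero] at h2
      simp only [coeff_sum, AddSubmonoidClass.coe_finsetSum] at h2
      refine Eq.trans (Finset.sum_congr rfl fun g _ => ?_) h2
      have h3 : groupRingAction p σ g (m (ω i) z) =
          MonoidAlgebra.single 1 (g • ω i) * groupRingAction p σ g z := by
        refine (map_mul (groupRingAction p σ g) _ z).trans ?_
        rw [groupRingAction_single, map_one]
      rw [h3, coeff_singleOne_mul, Subalgebra.coe_mul, mul_comm]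
      rfl
    -- The system shows that the coefficient at η of every g(z) vanishes; g = 1 recovers z.
    have h1 := congrFun h 1
    rw [Pi.zero_apply, map_one] at h1
    exact h1
  exact free_of_injective (projI ∘ₗ combA) (hprojI.comp hcombA_inj) (projA ∘ₗ combI)
    (hprojA.comp hcombI_inj)

end Ideals

theorem free_of_free_compHom {A A' M : Type*} [Semiring A] [Semiring A'] [AddCommMonoid M]
    [Module A' M]
    (φ : A ≃+* A') (h : @Module.Free A M _ _ (Module.compHom M φ.toRingHom)) :
    Module.Free A' M := by
  let _ : Module A M := Module.compHom M φ.toRingHom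
  have := RingHomInvPair.of_ringEquiv φ
  have := RingHomInvPair.symm (φ : A →+* A') (φ.symm : A' →+* A)
  let e : M ≃ₛₗ[(φ : A →+* A')] M :=
    { AddEquiv.refl M with map_smul' := fun _ _ => rfl }
  exact (Module.Free.iff_of_equiv e).1 h

/-! ### Regular subgroups normalized by translations -/

section Regular

variable {p : ℕ} [Fact p.Prime] {K L : Type*} [Field K] [Field L] [Algebra K L]
  [Algebra ℚ_[p] K] [FiniteDimensional ℚ_[p] K] [Algebra ℚ_[p] L] [FiniteDimensional ℚ_[p] L]
  [IsScalarTower ℚ_[p] K L] [IsGalois K L]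
  [Algebra ℤ_[p] K] [IsScalarTower ℤ_[p] ℚ_[p] K]
  [Algebra ℤ_[p] L] [IsScalarTower ℤ_[p] ℚ_[p] L] [IsScalarTower ℤ_[p] K L]
  {N : Subgroup (Equiv.Perm Gal(L/K))}

/-- Conjugation by left translations, as a homomorphism. -/
def conjHom (hnorm : IsTranslationNormalized N) : Gal(L/K) →* MulAut N where
  toFun := conj hnorm
  map_one' := MulEquiv.ext fun η => Subtype.ext <| by
    rw [coe_conj]
    refine Equiv.ext fun x => ?_
    simp
  map_mul' g h := MulEquiv.ext fun η => Subtype.ext <| by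
    rw [MulAut.mul_apply, coe_conj, coe_conj, coe_conj]
    refine Equiv.ext fun x => ?_
    simp [mul_assoc]

/-- A regular group of permutations is in bijection with the underlying set. -/
def regularEquiv (hreg : IsRegular N) : N ≃ Gal(L/K) :=
  Equiv.ofBijective (fun η => (η : Equiv.Perm Gal(L/K)) 1)
    ⟨fun η _ h => (hreg 1 ((η : Equiv.Perm Gal(L/K)) 1)).unique rfl h.symm,
      fun g => (hreg 1 g).exists⟩

/-- For g = η(1), the conjugate λ(g)μλ(g)⁻¹ sends g to gμ(1). This identity makes the embedding and
the projection linear over the fixed ring. -/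
theorem regularEquiv_conj_mul (hreg : IsRegular N) (hnorm : IsTranslationNormalized N) (η μ : N) :
    regularEquiv hreg (conj hnorm (regularEquiv hreg η) μ * η) =
      regularEquiv hreg η * regularEquiv hreg μ := by
  change ((conj hnorm (regularEquiv hreg η) μ : N) : Equiv.Perm Gal(L/K)) (regularEquiv hreg η) = _
  rw [coe_conj]
  simp [regularEquiv]
  rfl

/-- The group structure of a commutative group of permutations. -/
abbrev commGroupOfComm (hcomm : ∀ η ∈ N, ∀ μ ∈ N, η * μ = μ * η) : CommGroup N :=
  { (inferInstance : Group N) with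
    mul_comm := fun a b => Subtype.ext (hcomm a a.2 b b.2) }

end Regular

/-! ### The fixed ring, its flatness and semilocality -/

section Free

universe u v

variable {p : ℕ} [Fact p.Prime] {K : Type*} {L : Type v} [Field K] [Field L] [Algebra K L]
  [Algebra ℚ_[p] K] [FiniteDimensional ℚ_[p] K] [Algebra ℚ_[p] L] [FiniteDimensional ℚ_[p] L]
  [IsScalarTower ℚ_[p] K L] [IsGalois K L]
  [Algebra ℤ_[p] K] [IsScalarTower ℤ_[p] ℚ_[p] K]
  [Algebra ℤ_[p] L] [IsScalarTower ℤ_[p] ℚ_[p] L] [IsScalarTower ℤ_[p] K L]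

/-- The fixed ring of a twisted action on an abelian group ring `𝔒_L[N]` is semilocal, and `𝔒_L[N]`
is finite and flat over it. -/
theorem exists_flat_fixed_ring {N : Type u} [CommGroup N] [Finite N] (htame : IsTame p K L)
    (σ : Gal(L/K) →* MulAut N)
    (htriv : ∀ g ∈ inertiaGroup p K L, ∀ η : N, (∃ k : ℕ, η ^ p ^ k = 1) → σ g η = η) :
    ∃ (A : Type (max u v)) (_ : CommRing A) (_ : Algebra A (MonoidAlgebra (Integers p L) N)),
      (∀ (a : A) g, twist (MulSemiringAction.toRingHom Gal(L/K) (Integers p L) g)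
        (σ g).toMonoidHom (algebraMap A _ a) =
          algebraMap A (MonoidAlgebra (Integers p L) N) a) ∧
      Function.Injective (algebraMap A (MonoidAlgebra (Integers p L) N)) ∧
      (∀ z : MonoidAlgebra (Integers p L) N, (∀ g, twist (MulSemiringAction.toRingHom Gal(L/K)
        (Integers p L) g) (σ g).toMonoidHom z = z) → ∃ a : A, algebraMap A _ a = z) ∧
      Module.Flat A (MonoidAlgebra (Integers p L) N) ∧
      Module.Finite A (MonoidAlgebra (Integers p L) N) ∧ Finite (MaximalSpectrum A) := by
  let A := fixedGroupRing p (⊤ : Subgroup Gal(L/K)) fun g => (σ g).toMonoidHom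
  have : FiniteDimensional K L := FiniteDimensional.right ℚ_[p] K L
  let _ := Fintype.ofFinite N
  obtain ⟨P, Q, e, he, hQ, hP, hQf⟩ := exists_primary_decomposition p N
  have hflat : Module.Flat A (MonoidAlgebra (Integers p L) N) :=
    flat_over_fixedGroupRing htame e hQ σ
      (fun g => ((σ g).toMonoidHom.comp Q.subtype).codRestrict Q
        fun y => hQf (σ g).toMonoidHom y.1 y.2) fun g hg x y => by
      rw [he, he, map_mul]
      exact congrArg (· * _) (htriv g hg x.1 (hP x.1 x.2))
  have hfin : Module.Finite A (MonoidAlgebra (Integers p L) N) := finite_over_fixedGroupRing _ _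
  have : Module.Finite ℤ_[p] A := finite_fixedGroupRing _ _
  exact ⟨A, inferInstance, inferInstance, fun a g => a.2 g trivial, Subtype.val_injective,
    fun z hz => ⟨⟨z, fun g _ => hz g⟩, rfl⟩, hflat, hfin, finite_maximalSpectrum ℤ_[p] A⟩

end Free

end PadicHopfGalois

end

/-! ### Freeness of fractional ideals -/

open PadicHopfGalois in
theorem theorem3p1 (p : ℕ) [Fact p.Prime]
    -- `L/K` is a Galois extension of `p`-adic fields
    (K L : Type*) [Field K] [Field L]
    [Algebra ℚ_[p] K] [FiniteDimensional ℚ_[p] K] [Algebra ℚ_[p] L] [FiniteDimensional ℚ_[p] L]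
    [Algebra K L] [IsScalarTower ℚ_[p] K L] [IsGalois K L]
    -- the unique compatible `ℤ_p`-algebra structures
    [Algebra ℤ_[p] K] [IsScalarTower ℤ_[p] ℚ_[p] K]
    [Algebra ℤ_[p] L] [IsScalarTower ℤ_[p] ℚ_[p] L] [IsScalarTower ℤ_[p] K L]
    (htame : IsTame p K L)
    -- `N` is an abelian regular subgroup of `Perm(G)` normalized by `λ(G)`
    (N : Subgroup (Equiv.Perm Gal(L/K))) (hreg : IsRegular N) (hnorm : IsTranslationNormalized N)
    (hcomm : ∀ η ∈ N, ∀ μ ∈ N, η * μ = μ * η)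
    -- `G₀` acts trivially on the `p`-part of `N`
    (htriv : ∀ g ∈ inertiaGroup p K L, ∀ η ∈ pPart p N, conj hnorm g η = η)
    (B : FractionalIdeal (nonZeroDivisors (Integers p L)) L) :
    Module.Free (fixedOrder p hnorm) (B : Submodule (Integers p L) L) := by
  have := isDiscreteValuationRing_integers p L
  have := isFractionRing_integers p L
  let I : Submodule (Integers p L) L := B
  obtain ⟨b, hb⟩ := (FractionalIdeal.isPrincipal B).principal
  have hI : ∀ x, x ∈ I ↔ ∃ c : Integers p L, c * b = x := fun x => by
    change x ∈ (B : Submodule (Integers p L) L) ↔ _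
    rw [hb, Submodule.mem_span_singleton]
    rfl
  -- The zero ideal is free of rank 0; every other ideal has rank 1.
  rcases eq_or_ne b 0 with rfl | hb0
  · have : Subsingleton I := by
      refine ⟨fun x y => Subtype.ext ?_⟩
      obtain ⟨c, hc⟩ := (hI x).1 x.2
      obtain ⟨d, hd⟩ := (hI y).1 y.2
      rw [← hc, ← hd, mul_zero, mul_zero]
    exact Module.Free.of_subsingleton (fixedOrder p hnorm) I
  let _ : CommGroup N := commGroupOfComm hcomm
  have : FiniteDimensional K L := FiniteDimensional.right ℚ_[p] K L
  let _ := Fintype.ofFinite N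
  obtain ⟨A, _, _, hA, hinj, hA', _, _, _⟩ := exists_flat_fixed_ring htame (conjHom hnorm) htriv
  let φ : A ≃+* fixedOrder p hnorm :=
    RingEquiv.ofBijective ((algebraMap A (MonoidAlgebra (Integers p L) N)).codRestrict
      (fixedOrder p hnorm) fun a g => hA a g)
      ⟨fun a a' h => hinj (congrArg Subtype.val h), fun z => by
        obtain ⟨a, ha⟩ := hA' z.1 z.2
        exact ⟨a, Subtype.ext ha⟩⟩
  refine free_of_free_compHom (M := I) φ ?_
  let _ := Module.compHom I φ.toRingHom
  exact free_of_principal (conjHom hnorm) (regularEquiv hreg) (regularEquiv_conj_mul hreg hnorm) hA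
    (fun a x => Finsupp.sum_fintype (algebraMap A (MonoidAlgebra (Integers p L) N) a).coeff
      (fun (η : N) (c : Integers p L) => (c : L) * ((η : Equiv.Perm Gal(L/K))⁻¹ 1) x)
      fun η => zero_mul _) b hb0 hI htame hinj hA'
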